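/- \textbf{Setting.} Let $R$ be a commutative ring with an invertible element $A$ and an element $i$ with $i^2=-1$ (for instance $R=\mathbb{C}[A,A^{-1}]$). A virtual link diagram $K$ is a link diagram in the plane whose crossings are either classical (with over/under information) or virtual. Arrange $K$ with respect to the vertical direction, so that it is built from minima, maxima and crossings whose strands all run upwards. Let the indices run over $\{1,2\}$ and let $M_{ab}=M^{ab}$ with $M_{11}=M_{22}=0$, $M_{12}=iA$, $M_{21}=-iA^{-1}$. Assign $M_{ab}$ to each minimum, $M^{ab}$ to each maximum, where $a$ is the index of the left and $b$ that of the right strand. Assign to the classical crossings the tensors $$R^{ab}_{cd}=A\,M^{ab}M_{cd}+A^{-1}\delta^a_c\delta^b_d,\qquad \overline R^{ab}_{cd}=A^{-1}M^{ab}M_{cd}+A\,\delta^a_c\delta^b_d,$$ where $a,b$ (resp. $c,d$) are the indices of the left and right strand at the bottom (resp. at the top): $R$ if the overcrossing strand runs from bottom right to top left, and $\overline R$ if it runs from bottom left to top right. Assign to each virtual crossing the crossed Kronecker deltas $V^{ab}_{cd}=\delta^a_d\delta^b_c$. Let $Z(K)\in R$ be the sum, over all choices of indices, of the products of the corresponding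 entries. A state $S$ of $K$ is obtained by smoothing each classical crossing of $K$ in one of the two ways. The smoothing of type $a$ joins the two regions swept out by the overcrossing line when it is turned counterclockwise to the undercrossing line; it has weight $A$. The other smoothing, of type $b$, has weight $A^{-1}$. Let $\langle K|S\rangle$ be the product of these weights. The state $S$ is a collection of closed curves $C$ immersed in the plane (with virtual crossings only); let $\|S\|$ be their number, and let $\mathrm{rot}(C)\ge 0$ be the absolute value of the Whitney degree of $C$, i.e. of the total algebraic number of $2\pi$ turns of the unit tangent vector when $C$ is traversed once. Put $$d(C)=(-1)^{\mathrm{rot}(C)}\bigl(A^{2\,\mathrm{rot}(C)}+A^{-2\,\mathrm{rot}(C)}\bigr),\qquad d=-A^2-A^{-2},\qquad \langle K\rangle=\sum_S\langle K|S\rangle\, d^{\,\|S\|-1}.$$ \textbf{Proposition 9.} (1) $Z(K)$ is an invariant of virtual regular isotopy, that is, it does not change under planar isotopy and under all extended Reidemeister moves for virtual diagrams (classical, virtual, and the triangle move with two virtual crossings and one classical crossing) except the first classical and the first virtual move. (2) For every virtual link diagram $K$, $$Z(K)=\sum_S\langle K|S\rangle\prod_{C\in S}d(C).$$ (3) If $K$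 is a non-empty classical diagram (no virtual crossings), then $Z(K)=d\,\langle K\rangle$. -/

import Mathlib

/-!
Virtual link diagrams arranged with respect to the vertical direction, the tensor model `Z`,
the states of a diagram as systems of immersed plane curves, and the bracket state sum.
-/

namespace VirtualKnot

/-! ## Diagrams -/

/-- A crossing of two strands that both run upwards through it. It is either virtual or classical.
For a classical crossing, `slashOver = true` means that the strand from the bottom left to the top
right (the slash) is the overcrossing strand, and `slashOver = false` that the strand from the
bottom right to the top left (the backslash) is. -/
inductive Crossing where
  | classical (slashOver : Bool)
  | virt

/-- The crossing with over and under exchanged (a virtual crossing comes in one flavour only). -/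
def Crossing.switch : Crossing → Crossing
  | .classical o => .classical (!o)
  | .virt => .virt

/-- The elementary pieces of a diagram in general position with respect to the height. -/
inductive Piece where
  | minimum
  | maximum
  | crossing (c : Crossing)

/-- Number of strands that enter the piece from below. -/
def Piece.ins : Piece → ℕ
  | .minimum => 0
  | .maximum => 2
  | .crossing _ => 2

/-- Number of strands that leave the piece at the top. -/
def Piece.outs : Piece → ℕ
  | .minimum => 2
  | .maximum => 0
  | .crossing _ => 2

def Piece.isClassical : Piece → Bool
  | .crossing (.classical _) => true
  | _ => false

def Piece.isVirtual : Piece → Bool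
  | .crossing .virt => true
  | _ => false

/-- A horizontal slice of a diagram that contains one piece, with `left` strands passing on its
left and `right` strands passing on its right. -/
structure Layer where
  left : ℕ
  piece : Piece
  right : ℕ

/-- Number of points in which the diagram meets the lower boundary line of the layer. -/
def Layer.bot (L : Layer) : ℕ := L.left + L.piece.ins + L.right

/-- Number of points in which the diagram meets the upper boundary line of the layer. -/
def Layer.top (L : Layer) : ℕ := L.left + L.piece.outs + L.right

/-- The layers, listed from the bottom to the top, fit together, starting with `m` points on the
lowest line and ending with `n` points on the highest line. -/
def Fits : ℕ → List Layer → ℕ → Prop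
  | m, [], n => m = n
  | m, L :: w, n => L.bot = m ∧ Fits L.top w n

/-- A virtual link diagram arranged with respect to the vertical direction: a stack of layers,
from the bottom to the top, without boundary points. -/
structure Diagram where
  word : List Layer
  closed : Fits 0 word 0

namespace Diagram

/-- The number of layers. -/
abbrev size (K : Diagram) : ℕ := K.word.length

/-- The `k`-th layer; it lies between the heights `k` and `k + 1`. -/
abbrev layer (K : Diagram) (k : Fin K.size) : Layer := K.word.get k

/-- A classical diagram: no virtual crossings. -/
def IsClassical (K : Diagram) : Prop := ∀ L ∈ K.word, L.piece.isVirtual = false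

/-- Number of points of the diagram on the horizontal line at height `h`. -/
def width (K : Diagram) : ℕ → ℕ
  | 0 => 0
  | h + 1 => if hk : h < K.size then (K.layer ⟨h, hk⟩).top else 0

/-- The points of the diagram at the integral heights. -/
abbrev Point (K : Diagram) : Type := Σ h : Fin (K.size + 1), Fin (K.width h)

end Diagram

/-! ## Virtual regular isotopy -/

/-- The crossings `(a,b)`, `(a,c)`, `(b,c)` of three strands `a`, `b`, `c` (from left to right at
the bottom) for which the triangle move is allowed: one of the strands has only virtual crossings
with the other two, or all crossings are classical and one strand lies on top, one in the middle and
one at the bottom. -/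
def TriangleAllowed (ab ac bc : Crossing) : Prop :=
  (ab = .virt ∧ ac = .virt) ∨ (ab = .virt ∧ bc = .virt) ∨ (ac = .virt ∧ bc = .virt) ∨
  ∃ x y z : Bool, ab = .classical x ∧ ac = .classical y ∧ bc = .classical z ∧ (y = x ∨ y = z)

/-- Local moves on stacks of layers: the moves that generate planar isotopy of diagrams in general
position with respect to the height, and the extended Reidemeister moves without the first classical
and the first virtual one. -/
inductive LocalMove : List Layer → List Layer → Prop
  /-- exchange of the heights of two pieces beside each other -/
  | exchange (p q : Piece) (l m r : ℕ) :
      LocalMove [⟨l, p, m + q.ins + r⟩, ⟨l + p.outs + m, q, r⟩]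
        [⟨l + p.ins + m, q, r⟩, ⟨l, p, m + q.outs + r⟩]
  /-- cancellation of a minimum and a maximum -/
  | zigzagLeft (l r : ℕ) :
      LocalMove [⟨l, .minimum, r + 1⟩, ⟨l + 1, .maximum, r⟩] []
  | zigzagRight (l r : ℕ) :
      LocalMove [⟨l + 1, .minimum, r⟩, ⟨l, .maximum, r + 1⟩] []
  /-- sliding a strand through a maximum -/
  | slideMax (c : Crossing) (l r : ℕ) :
      LocalMove [⟨l, .crossing c, r + 1⟩, ⟨l + 1, .maximum, r⟩]
        [⟨l + 1, .crossing c.switch, r⟩, ⟨l, .maximum, r + 1⟩]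
  /-- sliding a strand through a minimum -/
  | slideMin (c : Crossing) (l r : ℕ) :
      LocalMove [⟨l, .minimum, r + 1⟩, ⟨l + 1, .crossing c, r⟩]
        [⟨l + 1, .minimum, r⟩, ⟨l, .crossing c.switch, r + 1⟩]
  /-- the second move, classical and virtual -/
  | second (c : Crossing) (l r : ℕ) :
      LocalMove [⟨l, .crossing c, r⟩, ⟨l, .crossing c.switch, r⟩] []
  /-- the third move, classical, virtual and mixed -/
  | third (ab ac bc : Crossing) (h : TriangleAllowed ab ac bc) (l r : ℕ) :
      LocalMove [⟨l, .crossing ab, r + 1⟩, ⟨l + 1, .crossing ac, r⟩, ⟨l, .crossing bc, r + 1⟩]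
        [⟨l + 1, .crossing bc, r⟩, ⟨l, .crossing ac, r + 1⟩, ⟨l + 1, .crossing ab, r⟩]

/-- `K'` arises from `K` by replacing a part of the stack by a local move. -/
def Move (K K' : Diagram) : Prop :=
  ∃ u v below above : List Layer, LocalMove u v ∧
    K.word = below ++ u ++ above ∧ K'.word = below ++ v ++ above

/-- Virtual regular isotopy of diagrams. -/
def VirtualRegularIsotopic : Diagram → Diagram → Prop := Relation.EqvGen Move

/-! ## The tensor model -/

section Tensor

variable {R : Type*} [CommRing R]

/-- The Kronecker delta. -/
def delta (a b : Fin 2) : R := if a = b then 1 else 0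

/-- The matrix `M` with rows `(0, iA)` and `(-iA⁻¹, 0)`, used for minima and for maxima. -/
def tensorM (A : Rˣ) (i : R) : Matrix (Fin 2) (Fin 2) R :=
  !![0, i * (A : R); -(i * ((A⁻¹ : Rˣ) : R)), 0]

/-- The tensor `R` with upper indices `a b` and lower indices `c d`. -/
def tensorR (A : Rˣ) (i : R) (a b c d : Fin 2) : R :=
  (A : R) * (tensorM A i a b * tensorM A i c d) + ((A⁻¹ : Rˣ) : R) * (delta a c * delta b d)

/-- The tensor `R̄` with upper indices `a b` and lower indices `c d`. -/
def tensorRbar (A : Rˣ) (i : R) (a b c d : Fin 2) : R :=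
  ((A⁻¹ : Rˣ) : R) * (tensorM A i a b * tensorM A i c d) + (A : R) * (delta a c * delta b d)

/-- The tensor of a virtual crossing: crossed Kronecker deltas. -/
def tensorV (a b c d : Fin 2) : R := delta a d * delta b c

/-- The tensor of a piece. The upper indices `a b` are those of the strands that enter from below,
the lower indices `c d` those of the strands that leave at the top; a minimum has no strands of the
first kind, a maximum none of the second. -/
def Piece.tensor (A : Rˣ) (i : R) : Piece → Fin 2 → Fin 2 → Fin 2 → Fin 2 → R
  | .minimum, _, _, c, d => tensorM A i c d
  | .maximum, a, b, _, _ => tensorM A i a b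
  | .crossing (.classical false), a, b, c, d => tensorR A i a b c d
  | .crossing (.classical true), a, b, c, d => tensorRbar A i a b c d
  | .crossing .virt, a, b, c, d => tensorV a b c d

/-- The tensor of a layer, with indices `a 0, a 1, …` on the lower line and `b 0, b 1, …` on the
upper line: the tensor of the piece times Kronecker deltas for the strands beside it. -/
def Layer.tensor (A : Rˣ) (i : R) (L : Layer) (a b : ℕ → Fin 2) : R :=
  (∏ j ∈ Finset.range L.left, delta (a j) (b j)) *
    L.piece.tensor A i (a L.left) (a (L.left + 1)) (b L.left) (b (L.left + 1)) *
    ∏ j ∈ Finset.range L.right,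
      delta (a (L.left + L.piece.ins + j)) (b (L.left + L.piece.outs + j))

/-- The index at the `p`-th point (from the left) at height `h`; the value `0` outside the diagram
is never used. -/
def Diagram.indexAt (K : Diagram) (s : K.Point → Fin 2) (h p : ℕ) : Fin 2 :=
  if hh : h < K.size + 1 then
    if hp : p < K.width h then s ⟨⟨h, hh⟩, ⟨p, hp⟩⟩ else 0
  else 0

/-- The evaluation `Z(K)` of the tensor expression of `K`: the sum, over all choices of indices, of
the products of the tensor entries. -/
def Diagram.Z (A : Rˣ) (i : R) (K : Diagram) : R :=
  ∑ s : K.Point → Fin 2, ∏ k : Fin K.size,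
    (K.layer k).tensor A i (K.indexAt s (k : ℕ)) (K.indexAt s ((k : ℕ) + 1))

end Tensor

/-! ## States -/

/-- The two smoothings of a classical crossing: type `a` joins the two regions that are swept out
when the overcrossing line is turned counterclockwise towards the undercrossing line, type `b` joins
the two other regions. -/
inductive Smoothing where
  | a
  | b
  deriving DecidableEq

instance : Fintype Smoothing where
  elems := {.a, .b}
  complete x := by cases x <;> simp

/-- The pieces of a smoothed diagram: minimum, maximum, virtual crossing, and a smoothed classical
crossing, where the result is either two vertical strands, or a maximum below a minimum. -/
inductive FlatPiece where
  | minimum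
  | maximum
  | cross
  | vertical
  | horizontal

/-- The result of smoothing a piece; pieces that are not classical crossings do not change. -/
def Piece.smooth : Piece → Smoothing → FlatPiece
  | .minimum, _ => .minimum
  | .maximum, _ => .maximum
  | .crossing .virt, _ => .cross
  | .crossing (.classical true), .a => .vertical
  | .crossing (.classical true), .b => .horizontal
  | .crossing (.classical false), .a => .horizontal
  | .crossing (.classical false), .b => .vertical

/-- An end of an arc in a layer: on the upper (`upper = true`) or lower line, with its position
from the left. -/
structure ArcEnd where
  upper : Bool
  pos : ℕ

/-- The other end of the arc that starts at `e`, in a layer with the piece `P` and `l` strands to the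
left of it. -/
def FlatPiece.otherEnd (P : FlatPiece) (l : ℕ) (e : ArcEnd) : ArcEnd :=
  if e.pos < l then ⟨!e.upper, e.pos⟩ else
  match P, e.upper with
  | .minimum, true =>
      if e.pos = l then ⟨true, l + 1⟩ else if e.pos = l + 1 then ⟨true, l⟩ else ⟨false, e.pos - 2⟩
  | .minimum, false => ⟨true, e.pos + 2⟩
  | .maximum, false =>
      if e.pos = l then ⟨false, l + 1⟩ else if e.pos = l + 1 then ⟨false, l⟩ else ⟨true, e.pos - 2⟩
  | .maximum, true => ⟨false, e.pos + 2⟩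
  | .cross, u =>
      if e.pos = l then ⟨!u, l + 1⟩ else if e.pos = l + 1 then ⟨!u, l⟩ else ⟨!u, e.pos⟩
  | .vertical, u => ⟨!u, e.pos⟩
  | .horizontal, u =>
      if e.pos = l then ⟨u, l + 1⟩ else if e.pos = l + 1 then ⟨u, l⟩ else ⟨!u, e.pos⟩

/-- The arc from `e` to `e'` in the layer between the heights `k` and `k + 1`, parametrised by
`[0, 1]`, as a curve in the plane `ℂ`. The `p`-th point at height `h` is `p + h i`. All arcs start
and end with vertical unit velocity, so that consecutive arcs form a `C¹` curve: a strand through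
the layer runs monotonically up or down, a maximum or minimum is half of an ellipse. -/
noncomputable def arcPath (k : ℕ) (e e' : ArcEnd) (t : ℝ) : ℂ :=
  let x : ℝ := e.pos
  let x' : ℝ := e'.pos
  let through : ℝ := x + (x' - x) * (3 * t ^ 2 - 2 * t ^ 3)
  let turn : ℝ := (x + x') / 2 + (x - x') / 2 * Real.cos (Real.pi * t)
  let bump : ℝ := Real.sin (Real.pi * t) / Real.pi
  match e.upper, e'.upper with
  | false, true => ⟨through, k + t⟩
  | true, false => ⟨through, k + 1 - t⟩
  | false, false => ⟨turn, k + bump⟩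
  | true, true => ⟨turn, k + 1 - bump⟩

/-- `θ` is a continuous choice of the direction of the tangent vector of the immersed curve `γ`. -/
def IsTangentAngle (γ : ℝ → ℂ) (θ : ℝ → ℝ) : Prop :=
  Continuous θ ∧ ∀ t, DifferentiableAt ℝ γ t ∧ deriv γ t ≠ 0 ∧
    deriv γ t = (‖deriv γ t‖ : ℂ) * Complex.exp (θ t * Complex.I)

open Classical in
/-- The Whitney degree of the closed immersed plane curve `γ` of period `T`: the algebraic number of
`2π` turns of the unit tangent vector as the curve is traversed once. -/
noncomputable def whitneyDegree (γ : ℝ → ℂ) (T : ℝ) : ℤ :=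
  if h : ∃ n : ℤ, ∃ θ : ℝ → ℝ, IsTangentAngle γ θ ∧ θ T - θ 0 = 2 * Real.pi * n
  then h.choose else 0

/-- An arc of a smoothed diagram with a direction: the arc that enters the layer with the number
`layer` at the end `start`. -/
structure RawDart where
  layer : ℕ
  start : ArcEnd

namespace Diagram

/-- The places of the classical crossings of `K`. -/
abbrev ClassicalCrossing (K : Diagram) : Type :=
  {k : Fin K.size // (K.layer k).piece.isClassical = true}

/-- A state of `K`: a choice of a smoothing for each classical crossing. -/
abbrev State (K : Diagram) : Type := K.ClassicalCrossing → Smoothing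

variable (K : Diagram)

/-- The piece of the state `S` in the `k`-th layer. -/
def flatPiece (S : K.State) (k : Fin K.size) : FlatPiece :=
  if h : (K.layer k).piece.isClassical = true then (K.layer k).piece.smooth (S ⟨k, h⟩)
  else (K.layer k).piece.smooth .a

/-- The other end of the arc of `S` that starts at `e` in the `k`-th layer. -/
def otherEnd (S : K.State) (k : ℕ) (e : ArcEnd) : ArcEnd :=
  if hk : k < K.size then (K.flatPiece S ⟨k, hk⟩).otherEnd (K.layer ⟨k, hk⟩).left e else e

/-- The same arc with the opposite direction. -/
def reverse (S : K.State) (x : RawDart) : RawDart := ⟨x.layer, K.otherEnd S x.layer x.start⟩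

/-- The next arc: if the arc `x` ends on the upper line of its layer, then the curve goes on upwards
in the layer above, otherwise downwards in the layer below. -/
def next (S : K.State) (x : RawDart) : RawDart :=
  let e := K.otherEnd S x.layer x.start
  if e.upper = true then ⟨x.layer + 1, ⟨false, e.pos⟩⟩ else ⟨x.layer - 1, ⟨true, e.pos⟩⟩

/-- The directed arcs of the states of `K`, given by their layer and their start on its lower or
upper line. -/
abbrev Dart : Type := Σ k : Fin K.size, Fin (K.layer k).bot ⊕ Fin (K.layer k).top

variable {K}

def Dart.raw (x : K.Dart) : RawDart :=
  match x with
  | ⟨k, .inl p⟩ => ⟨k, ⟨false, p⟩⟩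
  | ⟨k, .inr p⟩ => ⟨k, ⟨true, p⟩⟩

/-- The (unoriented) curves of a state: classes of directed arcs under passing to the next arc
and reversing the direction. -/
def Curve (S : K.State) : Type :=
  Quot fun x y : K.Dart => y.raw = K.next S x.raw ∨ y.raw = K.reverse S x.raw

instance (S : K.State) : Finite (Curve S) :=
  inferInstanceAs (Finite (Quot _))

noncomputable instance (S : K.State) : Fintype (Curve S) := Fintype.ofFinite _

/-- The number of arcs in the closed curve of `S` that starts with `x`. -/
noncomputable def period (S : K.State) (x : K.Dart) : ℕ :=
  Function.minimalPeriod (K.next S) x.raw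

/-- The closed curve of `S` that starts with the directed arc `x`, as an immersed plane curve
with the period `period S x`; each arc takes unit time. -/
noncomputable def curvePath (S : K.State) (x : K.Dart) (t : ℝ) : ℂ :=
  let y := (K.next S)^[(⌊t⌋ % (period S x : ℤ)).toNat] x.raw
  arcPath y.layer y.start (K.otherEnd S y.layer y.start) (Int.fract t)

/-- The absolute value of the Whitney degree of a curve `C` of `S`, computed from some starting
arc and direction; it depends on neither of them. -/
noncomputable def Curve.rot {S : K.State} (C : Curve S) : ℕ :=
  (whitneyDegree (curvePath S C.out) (period S C.out)).natAbs

/-! ## State sums -/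

section StateSum

variable {R : Type*} [CommRing R]

/-- The product `⟨K|S⟩` of the vertex weights of the state `S`. -/
def weight (A : Rˣ) (S : K.State) : R :=
  ∏ c : K.ClassicalCrossing, match S c with
    | .a => (A : R)
    | .b => ((A⁻¹ : Rˣ) : R)

/-- `d(C) = (-1)^rot(C) (A^(2 rot(C)) + A^(-2 rot(C)))`. -/
noncomputable def Curve.value (A : Rˣ) {S : K.State} (C : Curve S) : R :=
  (-1) ^ C.rot * ((A : R) ^ (2 * C.rot) + ((A⁻¹ : Rˣ) : R) ^ (2 * C.rot))

/-- `d = -A² - A⁻²`. -/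
def loopValue (A : Rˣ) : R := -(A : R) ^ 2 - ((A⁻¹ : Rˣ) : R) ^ 2

/-- The bracket `⟨K⟩`, where `‖S‖` is the number of curves of `S`. For the empty diagram, the
exponent `‖S‖ - 1` would be negative; this case is to be excluded. -/
noncomputable def bracket (A : Rˣ) (K : Diagram) : R :=
  ∑ S : K.State, weight A S * loopValue A ^ (Fintype.card (Curve S) - 1)

end StateSum

end Diagram

end VirtualKnot

/-!
The tensor sum `Z` is evaluated in two ways: layer by layer, as a composite of operators, and curve
by curve, as a sum over the orientations of the curves of each state.

**Invariance.** A layer acts linearly on functions of index sequences: a function of the indices on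
its upper line goes to a function of those on its lower line (`Box.op`). `Z(K)` is the composite of
these operators, applied to the constant function `1` (`Z_eq_wordOp`), so it suffices that each
local move is an identity of operators (`wordOp_localMove`). Pieces beside each other commute
(`Box.op_comm`), and since the matrix `M` is its own inverse, a minimum cancels against a maximum. A
classical crossing is a combination of the identity and a turnback, a maximum below a minimum; the
turnbacks satisfy the Temperley–Lieb relations, which give the second and third moves. A virtual
crossing exchanges two indices.

**States.** Expanding every classical crossing into its two smoothings writes `Z(K)` as a weighted
sum of tensor sums over the states (`Z_eq_sum_stateSum`). Put `u = iA`, so that `M` has the entries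
`0, u, u⁻¹, 0`. In a state, a labeling with non-zero weight is the same as an orientation of all
curves, where the first index means that the curve runs up and the second that it runs down. A
minimum or maximum contributes `u⁻¹` or `u` according as it is passed counterclockwise or clockwise
(`prod_stateTensor`). A curve which makes `t` counterclockwise half turns in one direction
contributes `u ^ t + u ^ (-t)` (`stateSum_eq_prod`). An explicit tangent angle along the curve,
glued from the angles along its arcs, shows that `t` is twice the Whitney degree
(`exists_whitneyDegree_eq`); with `u ^ 2 = -A ^ 2` the factor becomes `d(C)`.

**Classical diagrams.** If no virtual crossings occur, the minima and maxima of a state can be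
cancelled one by one, each cancellation being a zigzag or the removal of a circle of value `u ^ 2 +
u ^ (-2)`. Hence the sum of a state is `(u ^ 2 + u ^ (-2)) ^ N` for some `N`
(`exists_stateSum_eq_pow`). To see that `N` is the number `‖S‖` of curves, work over `R × ℤ` with
the unit `(u, 1)`: there the second coordinate of the product formula gives `2 ^ N = 2 ^ ‖S‖`, so
the Whitney degrees of embedded curves are not needed (`stateSum_eq_pow_card`).
-/

namespace VirtualKnot

/-! ### Tensors of layers as operators -/

section Operators

variable {R : Type*} [CommRing R]

/-- The sequence `a` with the two entries `x`, `y` inserted at the positions `l`, `l + 1`; the later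
entries move two places to the right. -/
def insertPair (l : ℕ) (x y : Fin 2) (a : ℕ → Fin 2) : ℕ → Fin 2 := fun p =>
  if p < l then a p else if p = l then x else if p = l + 1 then y else a (p - 2)

/-- The sequence `a` without its entries at the positions `l`, `l + 1`; the later entries move two
places to the left. -/
def deletePair (l : ℕ) (a : ℕ → Fin 2) : ℕ → Fin 2 := fun p =>
  if p < l then a p else a (p + 2)

/-- A tensor of one of the three shapes that occur in a layer: two strands leaving at the top, two
strands entering from below, or both. Both the pieces of a diagram and those of a state are of this
kind. -/
inductive Box (R : Type*) where
  | cup (M : Fin 2 → Fin 2 → R)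
  | cap (M : Fin 2 → Fin 2 → R)
  | cross (Q : Fin 2 → Fin 2 → Fin 2 → Fin 2 → R)

namespace Box

/-- Number of strands that enter from below. -/
def ins : Box R → ℕ
  | cup _ => 0
  | cap _ => 2
  | cross _ => 2

/-- Number of strands that leave at the top. -/
def outs : Box R → ℕ
  | cup _ => 2
  | cap _ => 0
  | cross _ => 2

/-- The tensor with the indices `a`, `b` on the lower and `c`, `d` on the upper line. -/
def tensor : Box R → Fin 2 → Fin 2 → Fin 2 → Fin 2 → R
  | cup M, _, _, c, d => M c d
  | cap M, a, b, _, _ => M a b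
  | cross Q, a, b, c, d => Q a b c d

/-- The tensor of a layer that contains `B`, with `l` strands on its left and `r` on its right; `a`
and `b` are the indices on the lower and on the upper line. -/
def layerTensor (l : ℕ) (B : Box R) (r : ℕ) (a b : ℕ → Fin 2) : R :=
  (∏ j ∈ Finset.range l, delta (a j) (b j)) *
    B.tensor (a l) (a (l + 1)) (b l) (b (l + 1)) *
    ∏ j ∈ Finset.range r, delta (a (l + B.ins + j)) (b (l + B.outs + j))

/-- The action of `B`, placed to the right of `l` strands, from functions of the indices on the
upper line to functions of those on the lower line. Index sequences are infinite, so the number of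
strands on the right of `B` does not enter. -/
def op (l : ℕ) : Box R → ((ℕ → Fin 2) → R) → (ℕ → Fin 2) → R
  | cup M, F, a => ∑ x, ∑ y, M x y * F (insertPair l x y a)
  | cap M, F, a => M (a l) (a (l + 1)) * F (deletePair l a)
  | cross Q, F, a =>
      ∑ x, ∑ y, Q (a l) (a (l + 1)) x y * F (insertPair l x y (deletePair l a))

end Box

/-- The continuation of a finite sequence by `0`. -/
def extend {n : ℕ} (c : Fin n → Fin 2) : ℕ → Fin 2 := fun p => if h : p < n then c ⟨p, h⟩ else 0

lemma extend_of_lt {n : ℕ} (c : Fin n → Fin 2) {p : ℕ} (h : p < n) : extend c p = c ⟨p, h⟩ :=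
  dif_pos h

lemma extend_of_le {n : ℕ} (c : Fin n → Fin 2) {p : ℕ} (h : n ≤ p) : extend c p = 0 :=
  dif_neg (by omega)

lemma extend_restrict {n : ℕ} {b : ℕ → Fin 2} (h : ∀ p, n ≤ p → b p = 0) :
    extend (fun p : Fin n => b p) = b := by
  funext p
  unfold extend
  split_ifs with hp
  · rfl
  · exact (h p (by omega)).symm

lemma prod_delta (n : ℕ) (f g : ℕ → Fin 2) :
    (∏ j ∈ Finset.range n, delta (f j) (g j) : R) = if ∀ j < n, f j = g j then 1 else 0 := by
  split_ifs with h
  · exact Finset.prod_eq_one fun j hj => by simp [delta, h j (Finset.mem_range.1 hj)]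
  · push Not at h
    obtain ⟨j, hj, hne⟩ := h
    exact Finset.prod_eq_zero (Finset.mem_range.2 hj) (by simp [delta, hne])

/-- A sum over all labelings of a line which only sees those of the form `H x y`, where `x` and `y`
are the entries at the positions `l` and `l + 1`, is a sum over `x` and `y`. -/
lemma sum_pair_of_extend_eq {m : ℕ} (G : (ℕ → Fin 2) → R) (H : Fin 2 → Fin 2 → ℕ → Fin 2)
    (l : ℕ) (hl : ∀ x y, H x y l = x ∧ H x y (l + 1) = y)
    (hsupp : ∀ x y p, m ≤ p → H x y p = 0)
    (hG : ∀ c : Fin m → Fin 2, (∀ x y, extend c ≠ H x y) → G (extend c) = 0) :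
    ∑ c : Fin m → Fin 2, G (extend c) = ∑ x, ∑ y, G (H x y) := by
  rw [← Fintype.sum_prod_type' (f := fun x y => G (H x y))]
  symm
  apply Finset.sum_of_injOn (fun (q : Fin 2 × Fin 2) (p : Fin m) => H q.1 q.2 p)
  · rintro ⟨x, y⟩ - ⟨x', y'⟩ - h
    have h' : H x y = H x' y' := by
      rw [← extend_restrict (hsupp x y), ← extend_restrict (hsupp x' y')]
      exact congrArg extend h
    have h1 := congrFun h' l
    have h2 := congrFun h' (l + 1)
    rw [(hl x y).1, (hl x' y').1] at h1
    rw [(hl x y).2, (hl x' y').2] at h2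
    rw [h1, h2]
  · intro q _
    simp
  · intro c _ hc
    apply hG
    intro x y hxy
    apply hc
    refine ⟨(x, y), by simp, ?_⟩
    funext p
    simp only [← hxy, extend_of_lt c p.2]
  · rintro ⟨x, y⟩ -
    simp only [extend_restrict (hsupp x y)]

/-- Summing the tensor of a layer over the indices on its upper line gives the operator `Box.op`:
the Kronecker deltas leave only the two indices at the upper ends of the box. -/
theorem Box.sum_layerTensor (l r : ℕ) (B : Box R) {m : ℕ} (hm : m = l + B.outs + r)
    (a : ℕ → Fin 2) (ha : ∀ p, l + B.ins + r ≤ p → a p = 0) (F : (ℕ → Fin 2) → R) :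
    ∑ c : Fin m → Fin 2, B.layerTensor l r a (extend c) * F (extend c) = B.op l F a := by
  cases B with
  | cup M =>
    simp only [Box.outs, Box.ins, Box.op] at *
    rw [sum_pair_of_extend_eq (fun b => (Box.cup M).layerTensor l r a b * F b)
      (fun x y => insertPair l x y a) l]
    · refine Finset.sum_congr rfl fun x _ => Finset.sum_congr rfl fun y _ => ?_
      simp only [Box.layerTensor, prod_delta, Box.tensor, Box.ins, Box.outs]
      rw [if_pos, if_pos]
      · simp [insertPair]
      · intro j hj
        simp only [insertPair]
        rw [if_neg (by omega), if_neg (by omega), if_neg (by omega)]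
        congr 1; omega
      · intro j hj
        simp [insertPair, hj]
    · intro x y
      simp [insertPair]
    · intro x y p hp
      simp only [insertPair]
      rw [if_neg (by omega), if_neg (by omega), if_neg (by omega)]
      exact ha _ (by omega)
    · intro c hc
      simp only [Box.layerTensor, prod_delta, Box.tensor, Box.ins, Box.outs]
      by_contra hne
      apply hc (extend c l) (extend c (l + 1))
      have h1 : ∀ j < l, a j = extend c j := by
        by_contra h; simp [h] at hne
      have h2 : ∀ j < r, a (l + 0 + j) = extend c (l + 2 + j) := by
        by_contra h; rw [if_neg h] at hne; simp at hne
      funext p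
      simp only [insertPair]
      split_ifs with h3 h4 h5
      · exact (h1 p h3).symm
      · rw [h4]
      · rw [h5]
      · by_cases hp : p < m
        · have := h2 (p - 2 - l) (by omega)
          rw [show l + 0 + (p - 2 - l) = p - 2 by omega,
            show l + 2 + (p - 2 - l) = p by omega] at this
          exact this.symm
        · rw [extend_of_le c (by omega), ha _ (by omega)]
  | cap M =>
    simp only [Box.outs, Box.ins, Box.op] at *
    have hsupp : ∀ p, m ≤ p → deletePair l a p = 0 := by
      intro p hp
      simp only [deletePair]
      rw [if_neg (by omega)]
      exact ha _ (by omega)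
    rw [Fintype.sum_eq_single (fun p : Fin m => deletePair l a p)]
    · rw [extend_restrict hsupp]
      simp only [Box.layerTensor, prod_delta, Box.tensor, Box.ins, Box.outs]
      rw [if_pos, if_pos]
      · simp
      · intro j hj
        simp only [deletePair]
        rw [if_neg (by omega)]
        congr 1; omega
      · intro j hj
        simp [deletePair, hj]
    · intro c hc
      simp only [Box.layerTensor, prod_delta, Box.tensor, Box.ins, Box.outs]
      by_contra hne
      apply hc
      have h1 : ∀ j < l, a j = extend c j := by
        by_contra h; simp [h] at hne
      have h2 : ∀ j < r, a (l + 2 + j) = extend c (l + 0 + j) := by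
        by_contra h; rw [if_neg h] at hne; simp at hne
      funext p
      rw [← Fin.eta p p.2, ← extend_of_lt c p.2]
      simp only [deletePair]
      split_ifs with h3
      · exact (h1 p h3).symm
      · have := h2 (p - l) (by omega)
        rw [show l + 2 + (p - l) = p + 2 by omega, show l + 0 + (p - l) = (p : ℕ) by omega] at this
        exact this.symm
  | cross Q =>
    simp only [Box.outs, Box.ins, Box.op] at *
    rw [sum_pair_of_extend_eq (fun b => (Box.cross Q).layerTensor l r a b * F b)
      (fun x y => insertPair l x y (deletePair l a)) l]
    · refine Finset.sum_congr rfl fun x _ => Finset.sum_congr rfl fun y _ => ?_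
      simp only [Box.layerTensor, prod_delta, Box.tensor, Box.ins, Box.outs]
      rw [if_pos, if_pos]
      · simp [insertPair]
      · intro j hj
        simp only [insertPair, deletePair]
        rw [if_neg (by omega), if_neg (by omega), if_neg (by omega), if_neg (by omega)]
        congr 1; omega
      · intro j hj
        simp [insertPair, deletePair, hj]
    · intro x y
      simp [insertPair]
    · intro x y p hp
      simp only [insertPair, deletePair]
      rw [if_neg (by omega), if_neg (by omega), if_neg (by omega), if_neg (by omega)]
      exact ha _ (by omega)
    · intro c hc
      simp only [Box.layerTensor, prod_delta, Box.tensor, Box.ins, Box.outs]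
      by_contra hne
      apply hc (extend c l) (extend c (l + 1))
      have h1 : ∀ j < l, a j = extend c j := by
        by_contra h; simp [h] at hne
      have h2 : ∀ j < r, a (l + 2 + j) = extend c (l + 2 + j) := by
        by_contra h; rw [if_neg h] at hne; simp at hne
      funext p
      simp only [insertPair, deletePair]
      split_ifs with h3 h4 h5
      · exact (h1 p h3).symm
      · rw [h4]
      · rw [h5]
      · omega
      · by_cases hp : p < m
        · have := h2 (p - 2 - l) (by omega)
          rw [show l + 2 + (p - 2 - l) = p by omega] at this
          rw [← this]
          congr 1; omega
        · rw [extend_of_le c (by omega), ha _ (by omega)]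

/-- The transfer matrix principle: if summing `t k` over the indices at height `k + 1` is the
operator `T k`, then the sum over the indices at all heights of the product of the `t k` is the
composite of the `T k`, applied to `1`. The weight `φ` on the lowest line absorbs the lowest factor
in the induction step. -/
theorem sum_prod_transfer : ∀ (n : ℕ) (W : ℕ → ℕ)
    (t : Fin n → (ℕ → Fin 2) → (ℕ → Fin 2) → R)
    (T : Fin n → ((ℕ → Fin 2) → R) → (ℕ → Fin 2) → R),
    (∀ (k : Fin n) (a : ℕ → Fin 2), (∀ p, W k ≤ p → a p = 0) → ∀ F : (ℕ → Fin 2) → R,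
      ∑ c : Fin (W (k + 1)) → Fin 2, t k a (extend c) * F (extend c) = T k F a) →
    ∀ φ : (ℕ → Fin 2) → R,
    ∑ g : (h : Fin (n + 1)) → Fin (W h) → Fin 2,
        φ (extend (g 0)) * ∏ k : Fin n, t k (extend (g k.castSucc)) (extend (g k.succ)) =
      ∑ c : Fin (W 0) → Fin 2,
        φ (extend c) * (List.ofFn T).foldr (fun f F => f F) 1 (extend c)
  | 0, W, t, T, _, φ => by
    simp only [Finset.univ_eq_empty, Finset.prod_empty, List.ofFn_zero, List.foldr_nil,
      Pi.one_apply]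
    exact (Equiv.piUnique (fun h : Fin 1 => Fin (W h) → Fin 2)).sum_comp
      (fun c : Fin (W 0) → Fin 2 => φ (extend c) * 1)
  | n + 1, W, t, T, h, φ => by
    rw [← (Fin.consEquiv (fun h : Fin (n + 2) => Fin (W h) → Fin 2)).sum_comp,
      Fintype.sum_prod_type]
    refine Finset.sum_congr rfl fun c _ => ?_
    have ih := sum_prod_transfer n (fun j => W (j + 1)) (fun k => t k.succ) (fun k => T k.succ)
      (fun k a ha F => h k.succ a ha F) (t 0 (extend c))
    rw [List.ofFn_succ, List.foldr_cons]
    have h0 := h 0 (extend c) (fun p hp => extend_of_le c hp)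
      ((List.ofFn fun k => T k.succ).foldr (fun f F => f F) 1)
    refine Eq.trans ?_ (congrArg (φ (extend c) * ·) (ih.trans h0))
    simp only [Finset.mul_sum]
    refine Finset.sum_congr rfl fun g _ => ?_
    rw [Fin.prod_univ_succ]
    rfl

end Operators

/-! ### Local moves as identities of operators -/

section Local
variable {R : Type*} [CommRing R]

section Sequences

variable (l m : ℕ) (x y z w : Fin 2) (a : ℕ → Fin 2)

lemma insertPair_self : insertPair l x y a l = x := by simp [insertPair]

lemma insertPair_self_succ : insertPair l x y a (l + 1) = y := by simp [insertPair]

lemma insertPair_right : insertPair l x y a (l + 2 + m) = a (l + m) := by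
  simp only [insertPair]
  rw [if_neg (by omega), if_neg (by omega), if_neg (by omega)]
  congr 1; omega

lemma insertPair_right_succ : insertPair l x y a (l + 2 + m + 1) = a (l + m + 1) :=
  insertPair_right l (m + 1) x y a

lemma insertPair_left : insertPair (l + 2 + m) x y a l = a l := by
  simp only [insertPair]
  rw [if_pos (by omega)]

lemma insertPair_left_succ : insertPair (l + 2 + m) x y a (l + 1) = a (l + 1) := by
  simp only [insertPair]
  rw [if_pos (by omega)]

lemma deletePair_right : deletePair l a (l + m) = a (l + 2 + m) := by
  simp only [deletePair]
  rw [if_neg (by omega)]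
  congr 1; omega

lemma deletePair_right_succ : deletePair l a (l + m + 1) = a (l + 2 + m + 1) :=
  deletePair_right l (m + 1) a

lemma deletePair_left : deletePair (l + 2 + m) a l = a l := by
  simp only [deletePair]
  rw [if_pos (by omega)]

lemma deletePair_left_succ : deletePair (l + 2 + m) a (l + 1) = a (l + 1) := by
  simp only [deletePair]
  rw [if_pos (by omega)]

lemma insertPair_insertPair : insertPair (l + 2 + m) z w (insertPair l x y a) =
    insertPair l x y (insertPair (l + m) z w a) := by
  funext p; simp only [insertPair]; split_ifs <;> first | rfl | omega

lemma deletePair_insertPair : deletePair (l + 2 + m) (insertPair l x y a) =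
    insertPair l x y (deletePair (l + m) a) := by
  funext p; simp only [insertPair, deletePair]
  split_ifs <;> first | rfl | omega | (congr 1; omega)

lemma insertPair_deletePair : insertPair (l + m) z w (deletePair l a) =
    deletePair l (insertPair (l + 2 + m) z w a) := by
  funext p; simp only [insertPair, deletePair]
  split_ifs <;> first | rfl | omega | (congr 1; omega)

lemma deletePair_deletePair : deletePair (l + m) (deletePair l a) =
    deletePair l (deletePair (l + 2 + m) a) := by
  funext p; simp only [deletePair]; split_ifs <;> first | rfl | omega

/-- The sequence `a` with the entries at `l`, `l + 1`, `l + 2` replaced by `x`, `y`, `z`. -/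
def setTriple : ℕ → Fin 2 := fun p =>
  if p = l then x else if p = l + 1 then y else if p = l + 2 then z else a p

lemma setTriple_self : setTriple l (a l) (a (l + 1)) (a (l + 2)) a = a := by
  funext p; simp only [setTriple]; split_ifs <;> simp only [*]

lemma setTriple_zero : setTriple l x y z a l = x := by simp [setTriple]

lemma setTriple_one : setTriple l x y z a (l + 1) = y := by simp [setTriple]

lemma setTriple_two : setTriple l x y z a (l + 2) = z := by simp [setTriple]

lemma insertPair_deletePair_setTriple (x' y' : Fin 2) :
    insertPair l x' y' (deletePair l (setTriple l x y z a)) = setTriple l x' y' z a := by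
  funext p; simp only [insertPair, deletePair, setTriple]
  split_ifs <;> first | rfl | omega | (congr 1; omega)

lemma insertPair_succ_deletePair_setTriple (y' z' : Fin 2) :
    insertPair (l + 1) y' z' (deletePair (l + 1) (setTriple l x y z a)) =
      setTriple l x y' z' a := by
  funext p; simp only [insertPair, deletePair, setTriple]
  split_ifs <;> first | rfl | omega | (congr 1; omega)

lemma deletePair_setTriple : deletePair l (setTriple l x y z a) =
    Function.update (deletePair l a) l z := by
  funext p; simp only [deletePair, setTriple, Function.update_apply]
  split_ifs <;> first | rfl | omega

lemma deletePair_succ_setTriple : deletePair (l + 1) (setTriple l x y z a) =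
    Function.update (deletePair l a) l x := by
  funext p; simp only [deletePair, setTriple, Function.update_apply]
  split_ifs <;> first | rfl | omega

lemma insertPair_eq_setTriple : insertPair l x y a =
    setTriple l x y (a l) (insertPair l 0 0 a) := by
  funext p; simp only [insertPair, setTriple]
  split_ifs <;> first | rfl | omega | (congr 1; omega)

lemma insertPair_succ_eq_setTriple : insertPair (l + 1) x y a =
    setTriple l (a l) x y (insertPair l 0 0 a) := by
  funext p; simp only [insertPair, setTriple]
  split_ifs <;> first | rfl | omega | congr 1

lemma deletePair_insertPair_self : deletePair l (insertPair l x y a) = a := by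
  funext p; simp only [insertPair, deletePair]
  split_ifs <;> first | rfl | omega

lemma insertPair_deletePair_self : insertPair l (a l) (a (l + 1)) (deletePair l a) = a := by
  funext p; simp only [insertPair, deletePair]
  split_ifs <;> first | rfl | omega | (congr 1; omega)

lemma deletePair_succ_insertPair :
    deletePair (l + 1) (insertPair l x y a) = Function.update a l x := by
  funext p; simp only [insertPair, deletePair, Function.update_apply]
  split_ifs <;> first | rfl | omega

lemma deletePair_insertPair_succ :
    deletePair l (insertPair (l + 1) x y a) = Function.update a l y := by
  funext p; simp only [insertPair, deletePair, Function.update_apply]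
  split_ifs <;> first | rfl | omega

end Sequences

namespace Box

/-- Two pieces in different columns commute; the position of the right one shifts by the change in
the number of strands that the left one causes. -/
theorem op_comm (B C : Box R) (l m : ℕ) (F : (ℕ → Fin 2) → R) :
    B.op l (C.op (l + B.outs + m) F) = C.op (l + B.ins + m) (B.op l F) := by
  funext a
  cases B <;> cases C <;>
  · simp only [op, ins, outs, Fin.sum_univ_two, add_zero, insertPair_right, insertPair_right_succ,
      insertPair_left, insertPair_left_succ, deletePair_right, deletePair_right_succ,
      deletePair_left, deletePair_left_succ, insertPair_insertPair, deletePair_insertPair,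
      insertPair_deletePair, deletePair_deletePair]
    ring

/-- The matrix with zero diagonal and the entries `u` and `u⁻¹` beside it. It is its own inverse. -/
def unitM (u : Rˣ) : Fin 2 → Fin 2 → R := !![0, (u : R); ((u⁻¹ : Rˣ) : R), 0]

variable (u : Rˣ) (l : ℕ) (F : (ℕ → Fin 2) → R)

/-- A zigzag of a minimum and a maximum is the identity. -/
theorem cup_cap_succ : (cup (unitM u)).op l ((cap (unitM u)).op (l + 1) F) = F := by
  funext a
  simp only [op, insertPair_self_succ, deletePair_succ_insertPair]
  have h0 : ∀ x y, insertPair l x y a (l + 1 + 1) = a l := fun x y => insertPair_right l 0 x y a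
  simp only [h0]
  have hs : Function.update a l (a l) = a := Function.update_eq_self l a
  rcases Fin.exists_fin_two.1 ⟨a l, rfl⟩ with h | h <;> rw [h] at hs ⊢ <;>
    simp [unitM, Fin.sum_univ_two, hs]

/-- The mirror image of the zigzag in `cup_cap_succ`. -/
theorem cup_succ_cap : (cup (unitM u)).op (l + 1) ((cap (unitM u)).op l F) = F := by
  funext a
  simp only [op, insertPair_self, deletePair_insertPair_succ]
  have h0 : ∀ x y, insertPair (l + 1) x y a l = a l := fun x y => by simp [insertPair]
  simp only [h0]
  have hs : Function.update a l (a l) = a := Function.update_eq_self l a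
  rcases Fin.exists_fin_two.1 ⟨a l, rfl⟩ with h | h <;> rw [h] at hs ⊢ <;>
    simp [unitM, Fin.sum_univ_two, hs]

/-- A circle has the value `u ^ 2 + u ^ (-2)`. -/
theorem cup_cap_self : (cup (unitM u)).op l ((cap (unitM u)).op l F) =
    fun a => ((u : R) ^ 2 + ((u⁻¹ : Rˣ) : R) ^ 2) * F a := by
  funext a
  simp only [op, insertPair_self, insertPair_self_succ, deletePair_insertPair_self]
  simp [unitM, Fin.sum_univ_two]
  ring

end Box

/-- The tensor of a piece of a diagram. -/
def Piece.box (A : Rˣ) (i : R) : Piece → Box R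
  | .minimum => .cup (tensorM A i)
  | .maximum => .cap (tensorM A i)
  | .crossing c => .cross ((Piece.crossing c).tensor A i)

lemma Piece.box_ins (A : Rˣ) (i : R) (P : Piece) : (P.box A i).ins = P.ins := by
  cases P <;> rfl

lemma Piece.box_outs (A : Rˣ) (i : R) (P : Piece) : (P.box A i).outs = P.outs := by
  cases P <;> rfl

lemma Piece.box_tensor (A : Rˣ) (i : R) (P : Piece) : (P.box A i).tensor = P.tensor A i := by
  cases P <;> rfl

/-- The action of a layer on functions of index sequences. -/
def Layer.op (A : Rˣ) (i : R) (L : Layer) : ((ℕ → Fin 2) → R) → (ℕ → Fin 2) → R :=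
  (L.piece.box A i).op L.left

/-- The composite of the actions of the layers of a stack, from the upper to the lower boundary. -/
def wordOp (A : Rˣ) (i : R) (w : List Layer) (F : (ℕ → Fin 2) → R) : (ℕ → Fin 2) → R :=
  w.foldr (fun L F => L.op A i F) F

/-- With the unit `u = iA`, the matrix `M` is `unitM u`. -/
lemma tensorM_eq (A : Rˣ) (i : R) (hi : i ^ 2 = -1) :
    ∃ u : Rˣ, (u : R) = i * A ∧ tensorM A i = Box.unitM u := by
  refine ⟨⟨i * A, -(i * ((A⁻¹ : Rˣ) : R)), ?_, ?_⟩, rfl, rfl⟩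
  · linear_combination (-(A * ((A⁻¹ : Rˣ) : R))) * hi + A.mul_inv
  · linear_combination (-(A * ((A⁻¹ : Rˣ) : R))) * hi + A.mul_inv

theorem sum_tensorM_mul_tensorM (A : Rˣ) (i : R) (hi : i ^ 2 = -1) (x z : Fin 2) :
    ∑ y, tensorM A i x y * tensorM A i y z = delta x z := by
  obtain ⟨u, -, hu⟩ := tensorM_eq A i hi
  rw [hu]
  fin_cases x <;> fin_cases z <;> simp [Box.unitM, delta, Fin.sum_univ_two]

lemma sum_delta_mul (x : Fin 2) (f : Fin 2 → R) : ∑ y, delta x y * f y = f x := by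
  simp [delta]

lemma sum_delta_mul' (x : Fin 2) (f : Fin 2 → R) : ∑ y, delta y x * f y = f x := by
  simp [delta]

lemma delta_comm (x y : Fin 2) : (delta x y : R) = delta y x := by
  simp [delta, eq_comm]

/-- The coefficient of the smoothing with a maximum below a minimum in the classical crossing
`classical s`. That of the smoothing with two vertical strands is `crossingCoeff A (!s)`. -/
def crossingCoeff (A : Rˣ) (s : Bool) : R := if s then ((A⁻¹ : Rˣ) : R) else A

lemma classical_tensor (A : Rˣ) (i : R) (s : Bool) (p q x y : Fin 2) :
    (Piece.crossing (.classical s)).tensor A i p q x y =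
      crossingCoeff A s * (tensorM A i p q * tensorM A i x y) +
        crossingCoeff A (!s) * (delta p x * delta q y) := by
  cases s <;> simp [Piece.tensor, tensorR, tensorRbar, crossingCoeff]

lemma crossingCoeff_mul (A : Rˣ) (s : Bool) :
    (crossingCoeff A s * crossingCoeff A (!s) : R) = 1 := by
  cases s <;> simp [crossingCoeff]

lemma crossingCoeff_sq_add (A : Rˣ) (s : Bool) :
    (crossingCoeff A s ^ 2 + crossingCoeff A (!s) ^ 2 : R) = A ^ 2 + ((A⁻¹ : Rˣ) : R) ^ 2 := by
  cases s <;> simp [crossingCoeff, add_comm]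

/-- Sliding a strand through a maximum, for tensor entries. -/
theorem tensor_slideMax (A : Rˣ) (i : R) (hi : i ^ 2 = -1) (c : Crossing) (p q r x : Fin 2) :
    ∑ y, (Piece.crossing c).tensor A i p q x y * tensorM A i y r =
      ∑ y, (Piece.crossing c.switch).tensor A i q r y x * tensorM A i p y := by
  cases c with
  | classical s =>
    have h1 : ∀ y, (Piece.crossing (.classical s)).tensor A i p q x y * tensorM A i y r =
        crossingCoeff A s * tensorM A i p q * (tensorM A i x y * tensorM A i y r) +
          crossingCoeff A (!s) * delta p x * (delta q y * tensorM A i y r) := fun y => by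
      rw [classical_tensor]; ring
    have h2 : ∀ y, (Piece.crossing (.classical !s)).tensor A i q r y x * tensorM A i p y =
        crossingCoeff A (!s) * tensorM A i q r * (tensorM A i p y * tensorM A i y x) +
          crossingCoeff A s * delta r x * (delta q y * tensorM A i p y) := fun y => by
      rw [classical_tensor, Bool.not_not]; ring
    simp only [Crossing.switch, h1, h2, Finset.sum_add_distrib, ← Finset.mul_sum,
      sum_tensorM_mul_tensorM A i hi, sum_delta_mul]
    rw [delta_comm x r]
    ring
  | virt =>
    simp only [Crossing.switch, Piece.tensor, tensorV, mul_assoc, sum_delta_mul]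
    rw [← sum_delta_mul p (fun y => delta q x * tensorM A i y r), sum_delta_mul,
      ← Finset.mul_sum, sum_delta_mul]

/-- Sliding a strand through a minimum, for tensor entries. -/
theorem tensor_slideMin (A : Rˣ) (i : R) (hi : i ^ 2 = -1) (c : Crossing) (p q r x : Fin 2) :
    ∑ y, tensorM A i x y * (Piece.crossing c).tensor A i y p q r =
      ∑ y, tensorM A i y r * (Piece.crossing c.switch).tensor A i p y x q := by
  cases c with
  | classical s =>
    have h1 : ∀ y, tensorM A i x y * (Piece.crossing (.classical s)).tensor A i y p q r =
        crossingCoeff A s * tensorM A i q r * (tensorM A i x y * tensorM A i y p) +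
          crossingCoeff A (!s) * delta p r * (delta y q * tensorM A i x y) := fun y => by
      rw [classical_tensor]; ring
    have h2 : ∀ y, tensorM A i y r * (Piece.crossing (.classical !s)).tensor A i p y x q =
        crossingCoeff A (!s) * tensorM A i x q * (tensorM A i p y * tensorM A i y r) +
          crossingCoeff A s * delta p x * (delta y q * tensorM A i y r) := fun y => by
      rw [classical_tensor, Bool.not_not]; ring
    simp only [Crossing.switch, h1, h2, Finset.sum_add_distrib, ← Finset.mul_sum,
      sum_tensorM_mul_tensorM A i hi, sum_delta_mul']
    rw [delta_comm x p]
    ring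
  | virt =>
    have h1 : ∀ y, tensorM A i x y * (Piece.crossing .virt).tensor A i y p q r =
        delta p q * (delta y r * tensorM A i x y) := fun y => by
      rw [Piece.tensor, tensorV]; ring
    have h2 : ∀ y, tensorM A i y r * (Piece.crossing .virt).tensor A i p y x q =
        delta p q * (delta y x * tensorM A i y r) := fun y => by
      rw [Piece.tensor, tensorV]; ring
    simp only [Crossing.switch, h1, h2, ← Finset.mul_sum, sum_delta_mul']

/-- Combinations of `1` with the generators `E` and `F` of a Temperley–Lieb algebra satisfy a
Yang–Baxter equation as soon as the coefficients of `E` and `F` on both sides agree. All other terms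
agree automatically. -/
theorem braid_of_temperleyLieb {S : Type*} [Ring S] [Algebra R S] {E F : S} {d : R}
    (hE : E * E = d • E) (hF : F * F = d • F) (hEFE : E * F * E = E) (hFEF : F * E * F = F)
    {a a' b b' c c' : R}
    (h : a * b * c + a * b' * c * d + a * b' * c' + a' * b' * c = a' * b * c') :
    (a • E + a' • 1) * (b • F + b' • 1) * (c • E + c' • 1) =
      (c • F + c' • 1) * (b • E + b' • 1) * (a • F + a' • 1) := by
  simp only [add_mul, mul_add, smul_mul_assoc, mul_smul_comm, mul_one, one_mul, hE, hF, hEFE, hFEF]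
  linear_combination (norm := module) h • E - h • F

/-- A maximum below a minimum, as an operator: a generator of the Temperley–Lieb algebra. -/
def turnback (A : Rˣ) (i : R) (l : ℕ) : Module.End R ((ℕ → Fin 2) → R) where
  toFun F := (Box.cap (tensorM A i)).op l ((Box.cup (tensorM A i)).op l F)
  map_add' F G := by
    funext a
    simp only [Box.op, Pi.add_apply, mul_add, Finset.sum_add_distrib]
  map_smul' r F := by
    funext a
    simp only [Box.op, Pi.smul_apply, smul_eq_mul, Finset.mul_sum, RingHom.id_apply]
    refine Finset.sum_congr rfl fun x _ => Finset.sum_congr rfl fun y _ => ?_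
    ring

/-- A classical crossing, as an operator. -/
def crossingEnd (A : Rˣ) (i : R) (s : Bool) (l : ℕ) : Module.End R ((ℕ → Fin 2) → R) :=
  (crossingCoeff A s : R) • turnback A i l + (crossingCoeff A (!s) : R) • 1

theorem op_classical (A : Rˣ) (i : R) (s : Bool) (l : ℕ) (F : (ℕ → Fin 2) → R) :
    ((Piece.crossing (.classical s)).box A i).op l F = crossingEnd A i s l F := by
  funext a
  have hF : F a = ∑ x, delta (a l) x * ∑ y, delta (a (l + 1)) y *
      F (insertPair l x y (deletePair l a)) := by
    rw [sum_delta_mul, sum_delta_mul, insertPair_deletePair_self]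
  change ∑ x, ∑ y, (Piece.crossing (.classical s)).tensor A i (a l) (a (l + 1)) x y *
      F (insertPair l x y (deletePair l a)) =
    crossingCoeff A s * (tensorM A i (a l) (a (l + 1)) *
      ∑ x, ∑ y, tensorM A i x y * F (insertPair l x y (deletePair l a))) +
        crossingCoeff A (!s) * F a
  rw [hF]
  simp only [Finset.mul_sum, ← Finset.sum_add_distrib, classical_tensor]
  refine Finset.sum_congr rfl fun x _ => Finset.sum_congr rfl fun y _ => ?_
  ring

theorem turnback_mul_self (A : Rˣ) (i : R) (hi : i ^ 2 = -1) (l : ℕ) :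
    turnback A i l * turnback A i l =
      (-((A : R) ^ 2 + ((A⁻¹ : Rˣ) : R) ^ 2)) • turnback A i l := by
  obtain ⟨u, hu, hM⟩ := tensorM_eq A i hi
  have hu' : ((u⁻¹ : Rˣ) : R) = -(i * ((A⁻¹ : Rˣ) : R)) := by
    have := congrFun (congrFun hM 1) 0
    simpa [tensorM, Box.unitM] using this.symm
  refine LinearMap.ext fun F => ?_
  change (Box.cap (tensorM A i)).op l ((Box.cup (tensorM A i)).op l
    ((Box.cap (tensorM A i)).op l ((Box.cup (tensorM A i)).op l F))) =
    (-((A : R) ^ 2 + ((A⁻¹ : Rˣ) : R) ^ 2)) •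
      (Box.cap (tensorM A i)).op l ((Box.cup (tensorM A i)).op l F)
  rw [hM, Box.cup_cap_self, hu, hu']
  funext a
  simp only [Box.op, Pi.smul_apply, smul_eq_mul]
  linear_combination (((A : R) ^ 2 + ((A⁻¹ : Rˣ) : R) ^ 2) * (Box.unitM u (a l) (a (l + 1)) *
    ∑ x, ∑ y, Box.unitM u x y * F (insertPair l x y (deletePair l a)))) * hi

theorem turnback_mul_succ_mul (A : Rˣ) (i : R) (hi : i ^ 2 = -1) (l : ℕ) :
    turnback A i l * turnback A i (l + 1) * turnback A i l = turnback A i l := by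
  obtain ⟨u, hu, hM⟩ := tensorM_eq A i hi
  refine LinearMap.ext fun F => ?_
  change (Box.cap (tensorM A i)).op l ((Box.cup (tensorM A i)).op l
    ((Box.cap (tensorM A i)).op (l + 1) ((Box.cup (tensorM A i)).op (l + 1)
    ((Box.cap (tensorM A i)).op l ((Box.cup (tensorM A i)).op l F))))) =
      (Box.cap (tensorM A i)).op l ((Box.cup (tensorM A i)).op l F)
  rw [hM, Box.cup_cap_succ, Box.cup_succ_cap]

theorem turnback_succ_mul_mul (A : Rˣ) (i : R) (hi : i ^ 2 = -1) (l : ℕ) :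
    turnback A i (l + 1) * turnback A i l * turnback A i (l + 1) = turnback A i (l + 1) := by
  obtain ⟨u, hu, hM⟩ := tensorM_eq A i hi
  refine LinearMap.ext fun F => ?_
  change (Box.cap (tensorM A i)).op (l + 1) ((Box.cup (tensorM A i)).op (l + 1)
    ((Box.cap (tensorM A i)).op l ((Box.cup (tensorM A i)).op l
    ((Box.cap (tensorM A i)).op (l + 1) ((Box.cup (tensorM A i)).op (l + 1) F))))) =
      (Box.cap (tensorM A i)).op (l + 1) ((Box.cup (tensorM A i)).op (l + 1) F)
  rw [hM, Box.cup_succ_cap, Box.cup_cap_succ]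

theorem crossingEnd_mul_crossingEnd_not (A : Rˣ) (i : R) (hi : i ^ 2 = -1) (s : Bool) (l : ℕ) :
    crossingEnd A i s l * crossingEnd A i (!s) l = 1 := by
  have h1 := crossingCoeff_mul A s
  have h2 := crossingCoeff_sq_add A s
  simp only [crossingEnd, Bool.not_not, add_mul, mul_add, smul_mul_assoc, mul_smul_comm, mul_one,
    one_mul, turnback_mul_self A i hi, ← h2]
  match_scalars
  · linear_combination (-(crossingCoeff A s ^ 2 + crossingCoeff A (!s) ^ 2)) * h1
  · linear_combination h1

/-- The third move. The condition on `s`, `t`, `v` says that the three strands can be put on three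
levels. -/
theorem crossingEnd_braid (A : Rˣ) (i : R) (hi : i ^ 2 = -1) {s t v : Bool}
    (h : t = s ∨ t = v) (l : ℕ) :
    crossingEnd A i s l * crossingEnd A i t (l + 1) * crossingEnd A i v l =
      crossingEnd A i v (l + 1) * crossingEnd A i t l * crossingEnd A i s (l + 1) := by
  refine braid_of_temperleyLieb (turnback_mul_self A i hi l) (turnback_mul_self A i hi (l + 1))
    (turnback_mul_succ_mul A i hi l) (turnback_succ_mul_mul A i hi l) ?_
  have hA := A.mul_inv
  rcases s with _ | _ <;> rcases t with _ | _ <;> rcases v with _ | _ <;>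
    simp [crossingCoeff, -Units.mul_inv, -Units.inv_mul] at h ⊢ <;> grind

theorem op_virt (A : Rˣ) (i : R) (l : ℕ) (F : (ℕ → Fin 2) → R) (a : ℕ → Fin 2) :
    ((Piece.crossing .virt).box A i).op l F a =
      F (insertPair l (a (l + 1)) (a l) (deletePair l a)) := by
  simp only [Piece.box, Box.op, Piece.tensor, tensorV, mul_assoc]
  rw [← sum_delta_mul (a (l + 1)) fun x => F (insertPair l x (a l) (deletePair l a))]
  refine Finset.sum_congr rfl fun x _ => ?_
  rw [← sum_delta_mul (a l) fun y => F (insertPair l x y (deletePair l a)), Finset.mul_sum]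
  refine Finset.sum_congr rfl fun y _ => ?_
  ring

lemma op_crossing (A : Rˣ) (i : R) (c : Crossing) (l : ℕ) (F : (ℕ → Fin 2) → R)
    (a : ℕ → Fin 2) : ((Piece.crossing c).box A i).op l F a =
      ∑ x, ∑ y, (Piece.crossing c).tensor A i (a l) (a (l + 1)) x y *
        F (insertPair l x y (deletePair l a)) := rfl

theorem op_third (A : Rˣ) (i : R) (hi : i ^ 2 = -1) {ab ac bc : Crossing}
    (h : TriangleAllowed ab ac bc) (l : ℕ) (F : (ℕ → Fin 2) → R) :
    ((Piece.crossing ab).box A i).op l (((Piece.crossing ac).box A i).op (l + 1)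
        (((Piece.crossing bc).box A i).op l F)) =
      ((Piece.crossing bc).box A i).op (l + 1) (((Piece.crossing ac).box A i).op l
        (((Piece.crossing ab).box A i).op (l + 1) F)) := by
  rcases h with ⟨rfl, rfl⟩ | ⟨rfl, rfl⟩ | ⟨rfl, rfl⟩ | ⟨s, t, v, rfl, rfl, rfl, h⟩
  · funext a
    rw [← setTriple_self l a]
    simp only [op_virt, op_crossing A i bc, insertPair_deletePair_setTriple,
      insertPair_succ_deletePair_setTriple, setTriple_zero, setTriple_one, setTriple_two,
      show l + 1 + 1 = l + 2 from rfl]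
  · funext a
    rw [← setTriple_self l a]
    simp only [op_virt, op_crossing A i ac, insertPair_deletePair_setTriple,
      insertPair_succ_deletePair_setTriple, setTriple_zero, setTriple_one, setTriple_two,
      show l + 1 + 1 = l + 2 from rfl]
  · funext a
    rw [← setTriple_self l a]
    simp only [op_virt, op_crossing A i ab, insertPair_deletePair_setTriple,
      insertPair_succ_deletePair_setTriple, setTriple_zero, setTriple_one, setTriple_two,
      show l + 1 + 1 = l + 2 from rfl]
  · simp only [op_classical]
    exact LinearMap.congr_fun (crossingEnd_braid A i hi h l) F

theorem op_second (A : Rˣ) (i : R) (hi : i ^ 2 = -1) (c : Crossing) (l : ℕ)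
    (F : (ℕ → Fin 2) → R) :
    ((Piece.crossing c).box A i).op l (((Piece.crossing c.switch).box A i).op l F) = F := by
  cases c with
  | classical s =>
    simp only [Crossing.switch, op_classical]
    exact LinearMap.congr_fun (crossingEnd_mul_crossingEnd_not A i hi s l) F
  | virt =>
    funext a
    simp only [Crossing.switch, op_virt, insertPair_self, insertPair_self_succ,
      deletePair_insertPair_self, insertPair_deletePair_self]

theorem op_slideMax (A : Rˣ) (i : R) (hi : i ^ 2 = -1) (c : Crossing) (l : ℕ)
    (F : (ℕ → Fin 2) → R) :
    ((Piece.crossing c).box A i).op l ((Piece.maximum.box A i).op (l + 1) F) =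
      ((Piece.crossing c.switch).box A i).op (l + 1) ((Piece.maximum.box A i).op l F) := by
  funext a
  rw [← setTriple_self l a]
  simp only [insertPair_deletePair_setTriple, Piece.box, Box.op,
      insertPair_succ_deletePair_setTriple, setTriple_zero, setTriple_one, setTriple_two,
      show l + 1 + 1 = l + 2 from rfl]
  simp only [deletePair_setTriple, deletePair_succ_setTriple]
  rw [Finset.sum_comm (γ := Fin 2) (s := Finset.univ) (t := Finset.univ)
    (f := fun x y => (Piece.crossing c.switch).tensor A i _ _ x y * _)]
  refine Finset.sum_congr rfl fun x _ => ?_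
  simp only [← mul_assoc, ← Finset.sum_mul]
  rw [tensor_slideMax A i hi]

theorem op_slideMin (A : Rˣ) (i : R) (hi : i ^ 2 = -1) (c : Crossing) (l : ℕ)
    (F : (ℕ → Fin 2) → R) :
    (Piece.minimum.box A i).op l (((Piece.crossing c).box A i).op (l + 1) F) =
      (Piece.minimum.box A i).op (l + 1) (((Piece.crossing c.switch).box A i).op l F) := by
  funext a
  change ∑ x, ∑ y, tensorM A i x y * _ = ∑ x, ∑ y, tensorM A i x y * _
  obtain ⟨b, h1, h2⟩ : ∃ b, (∀ x y, insertPair l x y a = setTriple l x y (a l) b) ∧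
      ∀ x y, insertPair (l + 1) x y a = setTriple l (a l) x y b :=
    ⟨_, fun x y => insertPair_eq_setTriple l x y a, fun x y => insertPair_succ_eq_setTriple l x y a⟩
  simp only [h1, h2]
  simp only [op_crossing, insertPair_deletePair_setTriple,
      insertPair_succ_deletePair_setTriple, setTriple_zero, setTriple_one, setTriple_two,
      show l + 1 + 1 = l + 2 from rfl, Finset.mul_sum]
  have h : ∀ x z w, (∑ y, tensorM A i x y * ((Piece.crossing c).tensor A i y (a l) z w *
      F (setTriple l x z w b))) = ∑ y, tensorM A i y w *
      ((Piece.crossing c.switch).tensor A i (a l) y x z *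
      F (setTriple l x z w b)) := fun x z w => by
    simp only [← mul_assoc, ← Finset.sum_mul]
    rw [tensor_slideMin A i hi]
  have hL : ∀ f : Fin 2 → Fin 2 → Fin 2 → Fin 2 → R, ∑ x, ∑ y, ∑ z, ∑ w, f x y z w =
      ∑ x, ∑ z, ∑ w, ∑ y, f x y z w := fun f => by
    simp only [Fin.sum_univ_two]; ring
  have hR : ∀ f : Fin 2 → Fin 2 → Fin 2 → Fin 2 → R, ∑ y, ∑ w, ∑ x, ∑ z, f y w x z =
      ∑ x, ∑ z, ∑ w, ∑ y, f y w x z := fun f => by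
    simp only [Fin.sum_univ_two]; ring
  refine (hL _).trans (Eq.trans ?_ (hR _).symm)
  exact Finset.sum_congr rfl fun x _ => Finset.sum_congr rfl fun z _ =>
    Finset.sum_congr rfl fun w _ => h x z w

theorem wordOp_localMove (A : Rˣ) (i : R) (hi : i ^ 2 = -1) {v w : List Layer}
    (h : LocalMove v w) (F : (ℕ → Fin 2) → R) : wordOp A i v F = wordOp A i w F := by
  obtain ⟨u, -, hM⟩ := tensorM_eq A i hi
  cases h with
  | exchange p q l m r =>
    have := Box.op_comm (p.box A i) (q.box A i) l m F
    rwa [Piece.box_ins, Piece.box_outs] at this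
  | zigzagLeft l r =>
    change (Box.cup (tensorM A i)).op l ((Box.cap (tensorM A i)).op (l + 1) F) = F
    rw [hM, Box.cup_cap_succ]
  | zigzagRight l r =>
    change (Box.cup (tensorM A i)).op (l + 1) ((Box.cap (tensorM A i)).op l F) = F
    rw [hM, Box.cup_succ_cap]
  | slideMax c l r => exact op_slideMax A i hi c l F
  | slideMin c l r => exact op_slideMin A i hi c l F
  | second c l r => exact op_second A i hi c l F
  | third ab ac bc h l r => exact op_third A i hi h l F

end Local

/-! ### The tensor model as a composition of operators -/

section Evaluation
variable {R : Type*} [CommRing R]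

/-- In a stack that fits together, each layer begins with as many points as the layer below it ends
with. -/
lemma Fits.bot_get : ∀ (w : List Layer) (m n : ℕ), Fits m w n →
    ∀ (k : ℕ) (hk : k < w.length),
      (w.get ⟨k, hk⟩).bot = if k = 0 then m else
        if h : k - 1 < w.length then (w.get ⟨k - 1, h⟩).top else 0
  | [], _, _, _, k, hk => absurd hk (by simp)
  | L :: w, m, n, h, 0, hk => h.1
  | L :: w, m, n, h, k + 1, hk => by
    have := Fits.bot_get w _ _ h.2 k (by simpa using hk)
    simp only [List.length_cons, List.get_eq_getElem] at *
    rw [List.getElem_cons_succ, this]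
    rcases k with _ | k
    · simp
    · simp

lemma Fits.top_last : ∀ (w : List Layer) (m n : ℕ), Fits m w n →
    ∀ h : 0 < w.length, (w.get ⟨w.length - 1, by omega⟩).top = n
  | [], _, _, _, h => absurd h (by simp)
  | [L], m, n, hf, _ => hf.2
  | L :: L' :: w, m, n, hf, h => by
    have := Fits.top_last (L' :: w) _ _ hf.2 (by simp)
    simpa using this

namespace Diagram
variable (K : Diagram)

lemma width_bot (k : Fin K.size) : K.width k = (K.layer k).bot := by
  have := Fits.bot_get K.word 0 0 K.closed k k.2
  rw [show (K.layer k).bot = _ from this]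
  rcases k with ⟨_ | k, hk⟩
  · simp [width]
  · simp only [width]
    rw [if_neg (by omega)]
    rfl

lemma width_top (k : Fin K.size) : K.width (k + 1) = (K.layer k).top := by
  simp [width]

lemma width_size : K.width K.size = 0 := by
  have := Fits.top_last K.word 0 0 K.closed
  unfold width
  split
  · rfl
  · rename_i h e
    rw [dif_pos (by omega)]
    rw [← this (by change 0 < K.size; omega)]
    congr 2
    change K.word.length = _ at e
    exact Fin.ext (by simp only; omega)

lemma indexAt_eq_extend (s : K.Point → Fin 2) (h : Fin (K.size + 1)) :
    K.indexAt s h = extend (fun p => s ⟨h, p⟩) := by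
  funext p
  simp only [indexAt, extend, h.2, dif_pos]

/-- A sum over all labelings of the points of `K` of a product of tensors, one for each layer, is
the composite of the corresponding operators. Both boundary lines of `K` are without points, so the
result can be read off at the sequence `0`. -/
lemma sum_point_eq (t : Fin K.size → (ℕ → Fin 2) → (ℕ → Fin 2) → R)
    (T : Fin K.size → ((ℕ → Fin 2) → R) → (ℕ → Fin 2) → R)
    (h : ∀ (k : Fin K.size) (a : ℕ → Fin 2), (∀ p, (K.layer k).bot ≤ p → a p = 0) →
      ∀ F : (ℕ → Fin 2) → R,
      ∑ c : Fin (K.width (k + 1)) → Fin 2, t k a (extend c) * F (extend c) = T k F a) :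
    ∑ s : K.Point → Fin 2, ∏ k : Fin K.size, t k (K.indexAt s k) (K.indexAt s (k + 1)) =
      (List.ofFn T).foldr (fun f F => f F) 1 0 := by
  have key := sum_prod_transfer K.size K.width t T
    (fun k a ha F => h k a (by rwa [← width_bot]) F) (fun _ => 1)
  rw [← (Equiv.piCurry
    (fun (h : Fin (K.size + 1)) (_ : Fin (K.width h)) => Fin 2)).sum_comp] at key
  simp only [one_mul] at key
  have h0 : ∀ c : Fin (K.width 0) → Fin 2, extend c = 0 := fun c =>
    funext fun p => extend_of_le c (Nat.zero_le p)
  simp only [h0] at key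
  rw [Finset.sum_const, Finset.card_univ] at key
  have hc : Fintype.card (Fin (K.width 0) → Fin 2) = 1 := by
    rw [Fintype.card_fun]
    rfl
  rw [hc, one_smul] at key
  rw [← key]
  refine Finset.sum_congr rfl fun s _ => Finset.prod_congr rfl fun k _ => ?_
  rw [show K.indexAt s k = _ from indexAt_eq_extend K s k.castSucc,
    show K.indexAt s (k + 1) = _ from indexAt_eq_extend K s k.succ]
  rfl

theorem Z_eq_wordOp (A : Rˣ) (i : R) : K.Z A i = wordOp A i K.word 1 0 := by
  have hL : ∀ (L : Layer) (a b : ℕ → Fin 2), L.tensor A i a b =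
      (L.piece.box A i).layerTensor L.left L.right a b := fun L a b => by
    rw [Box.layerTensor, Piece.box_ins, Piece.box_outs, Piece.box_tensor, Layer.tensor]
  unfold Z
  rw [K.sum_point_eq (fun k => (K.layer k).tensor A i) (fun k => (K.layer k).op A i)]
  · unfold wordOp
    rw [← List.foldr_map (f := Layer.op A i) (g := fun f F => f F)]
    rw [show (fun k => (K.layer k).op A i) = Layer.op A i ∘ K.word.get from rfl,
      ← List.map_ofFn, List.ofFn_get]
  · intro k a ha F
    simp only [hL]
    refine Box.sum_layerTensor _ _ _ ?_ a (fun p hp => ha p ?_) F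
    · rw [width_top, Layer.top, Piece.box_outs]
    · rwa [Piece.box_ins] at hp

theorem Z_eq_of_move (A : Rˣ) (i : R) (hi : i ^ 2 = -1) {K K' : Diagram} (h : Move K K') :
    K.Z A i = K'.Z A i := by
  obtain ⟨u, v, below, above, hm, hK, hK'⟩ := h
  rw [Z_eq_wordOp, Z_eq_wordOp, hK, hK']
  simp only [wordOp, List.foldr_append]
  rw [show List.foldr _ _ u = _ from wordOp_localMove A i hi hm _]
  rfl

theorem Z_eq_of_isotopic (A : Rˣ) (i : R) (hi : i ^ 2 = -1) {K K' : Diagram}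
    (h : VirtualRegularIsotopic K K') : K.Z A i = K'.Z A i := by
  induction h with
  | rel _ _ h => exact Z_eq_of_move A i hi h
  | refl _ => rfl
  | symm _ _ _ ih => exact ih.symm
  | trans _ _ _ _ _ ih ih' => exact ih.trans ih'

end Diagram
end Evaluation

/-! ### Expansion into states -/

section StateTensor
variable {R : Type*} [CommRing R]

/-- The tensor of a piece of a state, where minima and maxima have the matrix `unitM u`. -/
def FlatPiece.box (u : Rˣ) : FlatPiece → Box R
  | .minimum => .cup (Box.unitM u)
  | .maximum => .cap (Box.unitM u)
  | .cross => .cross tensorV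
  | .vertical => .cross fun a b c d => delta a c * delta b d
  | .horizontal => .cross fun a b c d => Box.unitM u a b * Box.unitM u c d

lemma FlatPiece.box_smooth_ins (u : Rˣ) (P : Piece) (σ : Smoothing) :
    ((P.smooth σ).box u).ins = P.ins := by
  rcases P with _ | _ | (_ | _) | _ <;> cases σ <;> rfl

lemma FlatPiece.box_smooth_outs (u : Rˣ) (P : Piece) (σ : Smoothing) :
    ((P.smooth σ).box u).outs = P.outs := by
  rcases P with _ | _ | (_ | _) | _ <;> cases σ <;> rfl

/-- The vertex weight of a smoothing. -/
def smoothingWeight (A : Rˣ) : Smoothing → R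
  | .a => A
  | .b => ((A⁻¹ : Rˣ) : R)

lemma sum_smoothing (f : Smoothing → R) : ∑ σ, f σ = f .a + f .b := by
  rw [show (Finset.univ : Finset Smoothing) = {.a, .b} from rfl]
  simp

theorem layer_tensor_of_classical (A : Rˣ) (i : R) (u : Rˣ) (hu : tensorM A i = Box.unitM u)
    (L : Layer) (h : L.piece.isClassical = true) (a b : ℕ → Fin 2) :
    L.tensor A i a b = ∑ σ, smoothingWeight A σ *
      ((L.piece.smooth σ).box u).layerTensor L.left L.right a b := by
  have key : ∀ p q x y, L.piece.tensor A i p q x y =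
      ∑ σ, smoothingWeight A σ * ((L.piece.smooth σ).box u).tensor p q x y := fun p q x y => by
    rw [sum_smoothing]
    rcases hP : L.piece with _ | _ | (_ | _) | _ <;> rw [hP] at h <;>
      simp [Piece.isClassical] at h <;>
      simp [Piece.tensor, Piece.smooth, FlatPiece.box, Box.tensor, smoothingWeight, tensorR,
        tensorRbar, hu, add_comm]
  unfold Layer.tensor Box.layerTensor
  simp only [FlatPiece.box_smooth_ins, FlatPiece.box_smooth_outs]
  rw [key, Finset.mul_sum, Finset.sum_mul]
  refine Finset.sum_congr rfl fun σ _ => ?_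
  ring

theorem layer_tensor_of_not_classical (A : Rˣ) (i : R) (u : Rˣ) (hu : tensorM A i = Box.unitM u)
    (L : Layer) (h : ¬ L.piece.isClassical = true) (a b : ℕ → Fin 2) :
    L.tensor A i a b = ((L.piece.smooth .a).box u).layerTensor L.left L.right a b := by
  have key : ∀ p q x y, L.piece.tensor A i p q x y =
      ((L.piece.smooth .a).box u).tensor p q x y := fun p q x y => by
    rcases hP : L.piece with _ | _ | (_ | _) | _ <;> rw [hP] at h <;>
      simp [Piece.isClassical] at h <;>
      simp [Piece.tensor, Piece.smooth, FlatPiece.box, Box.tensor, hu]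
  unfold Layer.tensor Box.layerTensor
  simp only [FlatPiece.box_smooth_ins, FlatPiece.box_smooth_outs]
  rw [key]

namespace Diagram
variable (K : Diagram)

/-- The tensor of the `k`-th layer of the state `S`. -/
def stateTensor (u : Rˣ) (S : K.State) (k : Fin K.size) : (ℕ → Fin 2) → (ℕ → Fin 2) → R :=
  ((K.flatPiece S k).box u).layerTensor (K.layer k).left (K.layer k).right

/-- The tensor sum of a state, without the vertex weights. -/
def stateSum (u : Rˣ) (S : K.State) : R :=
  ∑ s : K.Point → Fin 2, ∏ k : Fin K.size,
    K.stateTensor u S k (K.indexAt s k) (K.indexAt s (k + 1))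

/-- The expansion of all classical crossings into their smoothings. -/
theorem Z_eq_sum_stateSum (A : Rˣ) (i : R) (u : Rˣ) (hu : tensorM A i = Box.unitM u) :
    K.Z A i = ∑ S : K.State, weight A S * K.stateSum u S := by
  simp only [stateSum, Finset.mul_sum]
  rw [Finset.sum_comm]
  refine Finset.sum_congr rfl fun s _ => ?_
  rw [← Fintype.prod_subtype_mul_prod_subtype
    (fun k : Fin K.size => (K.layer k).piece.isClassical = true)]
  have h1 : ∀ c : K.ClassicalCrossing,
      (K.layer c).tensor A i (K.indexAt s (c : Fin K.size)) (K.indexAt s ((c : Fin K.size) + 1)) =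
      ∑ σ, smoothingWeight A σ * (((K.layer c).piece.smooth σ).box u).layerTensor (K.layer c).left
        (K.layer c).right (K.indexAt s (c : Fin K.size)) (K.indexAt s ((c : Fin K.size) + 1)) :=
    fun c => layer_tensor_of_classical A i u hu _ c.2 _ _
  rw [Finset.prod_congr rfl fun c _ => h1 c, Finset.prod_univ_sum, Fintype.piFinset_univ,
    Finset.sum_mul]
  refine Finset.sum_congr rfl fun S _ => ?_
  rw [← Fintype.prod_subtype_mul_prod_subtype
    (fun k : Fin K.size => (K.layer k).piece.isClassical = true)
    (fun k => K.stateTensor u S k (K.indexAt s k) (K.indexAt s (k + 1))), ← mul_assoc,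
    Finset.prod_mul_distrib]
  congr 1
  · congr 1
    refine Finset.prod_congr rfl fun c _ => ?_
    rw [stateTensor, flatPiece, dif_pos c.2]
  · refine Finset.prod_congr rfl fun c _ => ?_
    rw [stateTensor, flatPiece, dif_neg c.2]
    exact layer_tensor_of_not_classical A i u hu _ c.2 _ _

lemma flatPiece_ins (u : Rˣ) (S : K.State) (k : Fin K.size) :
    ((K.flatPiece S k).box u).ins = (K.layer k).piece.ins := by
  unfold flatPiece
  split_ifs <;> exact FlatPiece.box_smooth_ins _ _ _

lemma flatPiece_outs (u : Rˣ) (S : K.State) (k : Fin K.size) :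
    ((K.flatPiece S k).box u).outs = (K.layer k).piece.outs := by
  unfold flatPiece
  split_ifs <;> exact FlatPiece.box_smooth_outs _ _ _

theorem stateSum_eq_foldr (u : Rˣ) (S : K.State) : K.stateSum u S =
    (List.ofFn fun k => ((K.flatPiece S k).box u).op (K.layer k).left).foldr
      (fun f F => f F) 1 0 := by
  refine K.sum_point_eq _ _ fun k a ha F => ?_
  refine Box.sum_layerTensor _ _ _ ?_ a (fun p hp => ha p ?_) F
  · rw [width_top, Layer.top, flatPiece_outs]
  · rwa [flatPiece_ins] at hp

end Diagram

end StateTensor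

/-! ### States without virtual crossings -/

section PlanarState
variable {R : Type*} [CommRing R]

lemma Box.op_smul (B : Box R) (l : ℕ) (r : R) (F : (ℕ → Fin 2) → R) :
    B.op l (r • F) = r • B.op l F := by
  funext a
  cases B with
  | cap M => simp only [op, Pi.smul_apply, smul_eq_mul]; ring
  | cup M =>
    simp only [op, Pi.smul_apply, smul_eq_mul, Finset.mul_sum]
    exact Finset.sum_congr rfl fun x _ => Finset.sum_congr rfl fun y _ => by ring
  | cross Q =>
    simp only [op, Pi.smul_apply, smul_eq_mul, Finset.mul_sum]
    exact Finset.sum_congr rfl fun x _ => Finset.sum_congr rfl fun y _ => by ring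

/-- The list `c` describes a stack of minima that ends with `m` points on the highest line. The
positions of the minima are listed from the top downwards. -/
def CupFits : List ℕ → ℕ → Prop
  | [], m => m = 0
  | j :: c, m => j + 2 ≤ m ∧ CupFits c (m - 2)

/-- The action of a stack of minima; as in `CupFits`, the list begins with the highest one. -/
def cupsOp (u : Rˣ) : List ℕ → ((ℕ → Fin 2) → R) → (ℕ → Fin 2) → R
  | [], F => F
  | j :: c, F => cupsOp u c ((Box.cup (Box.unitM u)).op j F)

lemma cupsOp_smul (u : Rˣ) (r : R) : ∀ (c : List ℕ) (F : (ℕ → Fin 2) → R),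
    cupsOp u c (r • F) = r • cupsOp u c F
  | [], F => rfl
  | j :: c, F => by rw [cupsOp, Box.op_smul, cupsOp_smul u r c]; rfl

/-- A maximum on top of a stack of minima moves down until it meets a minimum with which it shares a
strand. It cancels against it, leaving a circle if both strands are shared. The exponent `e` and the
remaining stack do not depend on `F`. -/
theorem exists_cupsOp_cap (u : Rˣ) : ∀ (c : List ℕ) (m l : ℕ), CupFits c m → l + 2 ≤ m →
    ∃ (e : ℕ) (c' : List ℕ), CupFits c' (m - 2) ∧ ∀ F : (ℕ → Fin 2) → R,
      cupsOp u c ((Box.cap (Box.unitM u)).op l F) =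
        ((u : R) ^ 2 + ((u⁻¹ : Rˣ) : R) ^ 2) ^ e • cupsOp u c' F
  | [], m, l, hc, hl => by
    have : m = 0 := hc
    omega
  | j :: c, m, l, hc, hl => by
    obtain ⟨hj, hc⟩ := hc
    rcases lt_trichotomy j l with h | rfl | h
    · rcases Nat.lt_or_ge (j + 1) l with h' | h'
      · obtain ⟨n, rfl⟩ := Nat.exists_eq_add_of_le (show j + 2 ≤ l from h')
        obtain ⟨e, c', hc', h⟩ := exists_cupsOp_cap u c (m - 2) (j + n) hc (by omega)
        refine ⟨e, j :: c', ⟨by omega, hc'⟩, fun F => ?_⟩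
        have := Box.op_comm (Box.cup (Box.unitM u)) (Box.cap (Box.unitM u)) j n F
        rw [cupsOp, show (Box.cup (Box.unitM u)).op j ((Box.cap (Box.unitM u)).op (j + 2 + n) F)
          = _ from this]
        exact h _
      · obtain rfl : l = j + 1 := by omega
        exact ⟨0, c, hc, fun F => by rw [cupsOp, Box.cup_cap_succ, pow_zero, one_smul]⟩
    · exact ⟨1, c, hc, fun F => by
        rw [cupsOp, Box.cup_cap_self, pow_one, ← cupsOp_smul]; rfl⟩
    · rcases Nat.lt_or_ge (l + 1) j with h' | h'
      · obtain ⟨n, rfl⟩ := Nat.exists_eq_add_of_le (show l + 2 ≤ j from h')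
        obtain ⟨e, c', hc', h⟩ := exists_cupsOp_cap u c (m - 2) l hc (by omega)
        refine ⟨e, (l + n) :: c', ⟨by omega, hc'⟩, fun F => ?_⟩
        have := Box.op_comm (Box.cap (Box.unitM u)) (Box.cup (Box.unitM u)) l n F
        rw [cupsOp, ← show _ = (Box.cup (Box.unitM u)).op (l + 2 + n)
          ((Box.cap (Box.unitM u)).op l F) from this]
        exact h _
      · obtain rfl : j = l + 1 := by omega
        exact ⟨0, c, hc, fun F => by rw [cupsOp, Box.cup_succ_cap, pow_zero, one_smul]⟩

lemma op_vertical (u : Rˣ) (l : ℕ) (F : (ℕ → Fin 2) → R) :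
    (FlatPiece.vertical.box u).op l F = F := by
  funext a
  simp only [FlatPiece.box, Box.op, mul_assoc, ← Finset.mul_sum, sum_delta_mul,
    insertPair_deletePair_self]

lemma op_horizontal (u : Rˣ) (l : ℕ) (F : (ℕ → Fin 2) → R) :
    (FlatPiece.horizontal.box u).op l F =
      (Box.cap (Box.unitM u)).op l ((Box.cup (Box.unitM u)).op l F) := by
  funext a
  simp only [FlatPiece.box, Box.op, mul_assoc, ← Finset.mul_sum]

lemma Piece.smooth_ne_cross (P : Piece) (σ : Smoothing) (h : P.isVirtual = false) :
    P.smooth σ ≠ .cross := by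
  rcases P with _ | _ | (_ | _) | _ <;> cases σ <;> simp_all [Piece.isVirtual, Piece.smooth]

/-- A piece without crossings, put on top of a stack of minima, gives a stack of minima and possibly
a circle. -/
theorem exists_cupsOp_flatPiece (u : Rˣ) (P : FlatPiece) (hP : P ≠ .cross) (c : List ℕ)
    (l r m m' : ℕ) (hm : m = l + (P.box u).ins + r) (hm' : m' = l + (P.box u).outs + r)
    (hc : CupFits c m) :
    ∃ (e : ℕ) (c' : List ℕ), CupFits c' m' ∧ ∀ F : (ℕ → Fin 2) → R,
      cupsOp u c ((P.box u).op l F) =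
        ((u : R) ^ 2 + ((u⁻¹ : Rˣ) : R) ^ 2) ^ e • cupsOp u c' F := by
  cases P with
  | minimum =>
    simp only [FlatPiece.box, Box.ins, Box.outs] at *
    refine ⟨0, l :: c, ⟨by omega, ?_⟩, fun F => by rw [pow_zero, one_smul]; rfl⟩
    rwa [show m' - 2 = m by omega]
  | maximum =>
    simp only [FlatPiece.box, Box.ins, Box.outs] at *
    rw [show m' = m - 2 by omega]
    exact exists_cupsOp_cap u c m l hc (by omega)
  | cross => exact absurd rfl hP
  | vertical =>
    simp only [FlatPiece.box, Box.ins, Box.outs] at hm hm'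
    refine ⟨0, c, by rwa [hm', ← hm], fun F => ?_⟩
    rw [op_vertical, pow_zero, one_smul]
  | horizontal =>
    simp only [FlatPiece.box, Box.ins, Box.outs] at hm hm'
    obtain ⟨e, c', hc', h⟩ := exists_cupsOp_cap u c m l hc (by omega)
    refine ⟨e, l :: c', ⟨by omega, by rwa [hm', ← hm]⟩, fun F => ?_⟩
    rw [op_horizontal, h]
    rfl

namespace Diagram
variable (K : Diagram)

/-- A state without virtual crossings evaluates to a power of the value of a circle. -/
theorem exists_stateSum_eq_pow (u : Rˣ) (S : K.State) (hK : K.IsClassical) :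
    ∃ N : ℕ, K.stateSum u S = ((u : R) ^ 2 + ((u⁻¹ : Rˣ) : R) ^ 2) ^ N := by
  set T := List.ofFn fun k => ((K.flatPiece S k).box u).op (K.layer k).left with hT
  have key : ∀ j ≤ K.size, ∃ (e : ℕ) (c : List ℕ), CupFits c (K.width j) ∧
      ∀ F : (ℕ → Fin 2) → R, (T.take j).foldr (fun f F => f F) F =
        ((u : R) ^ 2 + ((u⁻¹ : Rˣ) : R) ^ 2) ^ e • cupsOp u c F := by
    intro j
    induction j with
    | zero => exact fun _ => ⟨0, [], rfl, fun F => by rw [pow_zero, one_smul]; rfl⟩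
    | succ j ih =>
      intro hj
      obtain ⟨e, c, hc, h⟩ := ih (by omega)
      have hP : K.flatPiece S ⟨j, hj⟩ ≠ .cross := by
        have h1 := hK _ (List.get_mem K.word ⟨j, hj⟩)
        unfold flatPiece
        split_ifs <;> exact Piece.smooth_ne_cross _ _ h1
      obtain ⟨e', c', hc', h'⟩ := exists_cupsOp_flatPiece (R := R) u _ hP c (K.layer ⟨j, hj⟩).left
        (K.layer ⟨j, hj⟩).right (K.width j) (K.width (j + 1))
        (by rw [flatPiece_ins]; exact K.width_bot ⟨j, hj⟩)
        (by rw [flatPiece_outs]; exact K.width_top ⟨j, hj⟩) hc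
      refine ⟨e + e', c', hc', fun F => ?_⟩
      have hlen : j < T.length := by rw [hT, List.length_ofFn]; exact hj
      rw [← List.take_append_getElem hlen, List.foldr_append, h, List.foldr_cons, List.foldr_nil,
        pow_add, mul_smul, ← h']
      rw [List.getElem_of_eq hT hlen, List.getElem_ofFn]
  obtain ⟨e, c, hc, h⟩ := key K.size le_rfl
  rw [width_size] at hc
  refine ⟨e, ?_⟩
  rw [stateSum_eq_foldr, ← hT]
  have hTt : T.take K.size = T := List.take_of_length_le (by simp [hT])
  rw [hTt] at h
  rw [h]
  rcases c with _ | ⟨j, c⟩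
  · simp [cupsOp]
  · exact absurd hc.1 (by omega)

end Diagram

end PlanarState

/-! ### The tensor of a smoothed layer -/

section FlatLayer

namespace FlatPiece

/-- Number of strands that enter from below. -/
def ins : FlatPiece → ℕ
  | .minimum => 0
  | _ => 2

/-- Number of strands that leave at the top. -/
def outs : FlatPiece → ℕ
  | .maximum => 0
  | _ => 2

/-- `e` is an end of an arc in the layer with the piece `P`, `l` strands on its left and `r` strands
on its right. -/
def IsEnd (P : FlatPiece) (l r : ℕ) (e : ArcEnd) : Prop :=
  e.pos < l + (if e.upper = true then P.outs else P.ins) + r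

section
variable (P : FlatPiece) (l r : ℕ)

lemma otherEnd_left (up : Bool) {j : ℕ} (h : j < l) : P.otherEnd l ⟨up, j⟩ = ⟨!up, j⟩ := by
  simp [otherEnd, h]

lemma otherEnd_lower (j : ℕ) : P.otherEnd l ⟨false, l + P.ins + j⟩ = ⟨true, l + P.outs + j⟩ := by
  have h1 : ¬ l + 0 + j < l := by omega
  have h2 : ¬ l + 2 + j < l := by omega
  have h3 : ¬ l + 2 + j = l := by omega
  have h4 : ¬ l + 2 + j = l + 1 := by omega
  have h5 : l + 2 + j - 2 = l + 0 + j := by omega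
  have h6 : l + 0 + j + 2 = l + 2 + j := by omega
  cases P <;> simp only [otherEnd, ins, outs, h1, h2, h3, h4, h5, h6, if_false, Bool.not_false]

lemma otherEnd_upper (j : ℕ) : P.otherEnd l ⟨true, l + P.outs + j⟩ = ⟨false, l + P.ins + j⟩ := by
  have h1 : ¬ l + 0 + j < l := by omega
  have h2 : ¬ l + 2 + j < l := by omega
  have h3 : ¬ l + 2 + j = l := by omega
  have h4 : ¬ l + 2 + j = l + 1 := by omega
  have h5 : l + 2 + j - 2 = l + 0 + j := by omega
  have h6 : l + 0 + j + 2 = l + 2 + j := by omega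
  cases P <;> simp only [otherEnd, ins, outs, h1, h2, h3, h4, h5, h6, if_false, Bool.not_true]

/-- The ends of arcs in a layer belong to the strands on the left, to the strands on the right, or
to the piece. -/
lemma forall_isEnd_iff (p : ArcEnd → Prop) : (∀ e, P.IsEnd l r e → p e) ↔
    (∀ j < l, p ⟨false, j⟩ ∧ p ⟨true, j⟩) ∧
    (∀ j < r, p ⟨false, l + P.ins + j⟩ ∧ p ⟨true, l + P.outs + j⟩) ∧
    (∀ j < P.ins, p ⟨false, l + j⟩) ∧ (∀ j < P.outs, p ⟨true, l + j⟩) := by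
  constructor
  · intro h
    refine ⟨fun j hj => ⟨h _ ?_, h _ ?_⟩, fun j hj => ⟨h _ ?_, h _ ?_⟩, fun j hj => h _ ?_,
      fun j hj => h _ ?_⟩ <;> simp [IsEnd] <;> omega
  · rintro ⟨h1, h2, h3, h4⟩ ⟨_ | _, p⟩ he <;>
      simp only [IsEnd, if_true, if_false, Bool.false_eq_true] at he
    · rcases Nat.lt_or_ge p l with h | h
      · exact (h1 p h).1
      rcases Nat.lt_or_ge p (l + P.ins) with h' | h'
      · have := h3 (p - l) (by omega)
        rwa [show l + (p - l) = p by omega] at this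
      · have := (h2 (p - l - P.ins) (by omega)).1
        rwa [show l + P.ins + (p - l - P.ins) = p by omega] at this
    · rcases Nat.lt_or_ge p l with h | h
      · exact (h1 p h).2
      rcases Nat.lt_or_ge p (l + P.outs) with h' | h'
      · have := h4 (p - l) (by omega)
        rwa [show l + (p - l) = p by omega] at this
      · have := (h2 (p - l - P.outs) (by omega)).2
        rwa [show l + P.outs + (p - l - P.outs) = p by omega] at this

theorem isEnd_otherEnd : ∀ e, P.IsEnd l r e → P.IsEnd l r (P.otherEnd l e) := by
  rw [forall_isEnd_iff]
  refine ⟨fun j hj => ?_, fun j hj => ?_, ?_, ?_⟩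
  · rw [otherEnd_left _ _ _ hj, otherEnd_left _ _ _ hj]
    simp only [IsEnd, Bool.not_false, Bool.not_true]
    omega
  · rw [otherEnd_lower, otherEnd_upper]
    simp only [IsEnd]
    simp [hj]
  · intro j hj
    cases P <;> simp only [ins] at hj <;> interval_cases j <;>
      simp [otherEnd, IsEnd, ins, outs] <;> omega
  · intro j hj
    cases P <;> simp only [outs] at hj <;> interval_cases j <;>
      simp [otherEnd, IsEnd, ins, outs] <;> omega

theorem otherEnd_otherEnd : ∀ e, P.IsEnd l r e → P.otherEnd l (P.otherEnd l e) = e := by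
  rw [forall_isEnd_iff]
  refine ⟨fun j hj => ?_, fun j hj => ?_, ?_, ?_⟩
  · rw [otherEnd_left _ _ _ hj, otherEnd_left _ _ _ hj, otherEnd_left _ _ _ hj,
      otherEnd_left _ _ _ hj]
    exact ⟨rfl, rfl⟩
  · rw [otherEnd_lower, otherEnd_upper, otherEnd_lower]
    exact ⟨rfl, rfl⟩
  · intro j hj
    cases P <;> simp only [ins] at hj <;> interval_cases j <;> simp [otherEnd]
  · intro j hj
    cases P <;> simp only [outs] at hj <;> interval_cases j <;> simp [otherEnd]

/-- An arc with both ends on the same line is a minimum or maximum between neighbouring points. -/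
theorem pos_otherEnd_of_upper_eq : ∀ e, P.IsEnd l r e → (P.otherEnd l e).upper = e.upper →
    (P.otherEnd l e).pos = e.pos + 1 ∨ e.pos = (P.otherEnd l e).pos + 1 := by
  rw [forall_isEnd_iff]
  refine ⟨fun j hj => ?_, fun j hj => ?_, ?_, ?_⟩
  · rw [otherEnd_left _ _ _ hj, otherEnd_left _ _ _ hj]
    simp
  · rw [otherEnd_lower, otherEnd_upper]
    simp
  · intro j hj
    cases P <;> simp only [ins] at hj <;> interval_cases j <;> simp [otherEnd]
  · intro j hj
    cases P <;> simp only [outs] at hj <;> interval_cases j <;> simp [otherEnd]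

end

end FlatPiece

/-- The number of counterclockwise half turns of the arc that runs from `e` to `e'`: `1` for a
minimum passed from left to right or a maximum passed from right to left, `-1` for the opposite
directions, `0` for a strand through the layer. -/
def arcTurn (e e' : ArcEnd) : ℤ :=
  if e'.upper = e.upper then (if decide (e.pos < e'.pos) = e.upper then 1 else -1) else 0

lemma arcTurn_of_ne {e e' : ArcEnd} (h : e'.upper ≠ e.upper) : arcTurn e e' = 0 := if_neg h

lemma arcTurn_symm {e e' : ArcEnd} (h : e'.upper = e.upper → e'.pos ≠ e.pos) :
    arcTurn e' e = -arcTurn e e' := by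
  unfold arcTurn
  by_cases hu : e'.upper = e.upper
  · rcases lt_or_gt_of_ne (h hu) with h' | h' <;> cases h1 : e.upper <;>
      simp [hu, h1, h', h'.not_gt]
  · rw [if_neg hu, if_neg (Ne.symm hu), neg_zero]

section Labels

/-- The labels `a` on the lower and `b` on the upper line are read as directions, `0` for up and `1`
for down. The end `e` is aligned if its label directs the arc away from `e`, into the layer. -/
def IsAligned (a b : ℕ → Fin 2) (e : ArcEnd) : Prop :=
  if e.upper = true then b e.pos = 1 else a e.pos = 0

instance (a b : ℕ → Fin 2) (e : ArcEnd) : Decidable (IsAligned a b e) := by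
  unfold IsAligned; infer_instance

variable {R : Type*} [CommRing R]

/-- The power of `u` that the arc starting at `e` contributes if it is directed away from `e`. -/
def FlatPiece.endWeight (P : FlatPiece) (l : ℕ) (u : Rˣ) (a b : ℕ → Fin 2) (e : ArcEnd) : Rˣ :=
  if IsAligned a b e then u ^ (-arcTurn e (P.otherEnd l e)) else 1

lemma FlatPiece.box_ins (u : Rˣ) (P : FlatPiece) : (P.box u).ins = P.ins := by
  cases P <;> rfl

lemma FlatPiece.box_outs (u : Rˣ) (P : FlatPiece) : (P.box u).outs = P.outs := by
  cases P <;> rfl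

/-- The labels direct each arc of the piece itself away from exactly one of its ends. -/
def FlatPiece.MidAligned (P : FlatPiece) (l : ℕ) (a b : ℕ → Fin 2) : Prop :=
  (∀ j < P.ins, IsAligned a b (P.otherEnd l ⟨false, l + j⟩) ↔ ¬ IsAligned a b ⟨false, l + j⟩) ∧
    ∀ j < P.outs, IsAligned a b (P.otherEnd l ⟨true, l + j⟩) ↔ ¬ IsAligned a b ⟨true, l + j⟩

open Classical in
lemma FlatPiece.tensor_eq_ite (P : FlatPiece) (l : ℕ) (u : Rˣ) (a b : ℕ → Fin 2) :
    (P.box u).tensor (a l) (a (l + 1)) (b l) (b (l + 1)) = if P.MidAligned l a b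
      then (((∏ j ∈ Finset.range P.ins, P.endWeight l u a b ⟨false, l + j⟩) *
        ∏ j ∈ Finset.range P.outs, P.endWeight l u a b ⟨true, l + j⟩ : Rˣ) : R) else 0 := by
  have e1 : ∀ q : ℕ → Prop, (∀ j < 2, q j) ↔ q 0 ∧ q 1 := fun q =>
    ⟨fun h => ⟨h 0 (by omega), h 1 (by omega)⟩, fun h j hj => by
      interval_cases j; exacts [h.1, h.2]⟩
  have e2 : ∀ x : Fin 2, x = 0 ∨ x = 1 := fun x => Fin.exists_fin_two.1 ⟨x, rfl⟩
  cases P with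
  | minimum =>
    simp only [MidAligned, endWeight, ins, outs, e1, Nat.not_lt_zero, false_imp_iff, implies_true,
      true_and, Finset.prod_range_succ, Finset.prod_range_zero, one_mul, add_zero]
    rcases e2 (b l) with h0 | h0 <;>
    rcases e2 (b (l + 1)) with h1 | h1 <;>
    simp [otherEnd, IsAligned, box, Box.tensor, arcTurn, Box.unitM, h0, h1]
  | maximum =>
    simp only [MidAligned, endWeight, ins, outs, e1, Nat.not_lt_zero, false_imp_iff, implies_true,
      and_true, Finset.prod_range_succ, Finset.prod_range_zero, one_mul, mul_one, add_zero]
    rcases e2 (a l) with h0 | h0 <;>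
    rcases e2 (a (l + 1)) with h1 | h1 <;>
    simp [otherEnd, IsAligned, box, Box.tensor, arcTurn, Box.unitM, h0, h1]
  | cross =>
    simp only [MidAligned, endWeight, ins, outs, e1, Finset.prod_range_succ,
      Finset.prod_range_zero, one_mul, add_zero]
    rcases e2 (a l) with h0 | h0 <;>
    rcases e2 (a (l + 1)) with h1 | h1 <;>
    rcases e2 (b l) with h2 | h2 <;>
    rcases e2 (b (l + 1)) with h3 | h3 <;>
    simp [otherEnd, IsAligned, box, Box.tensor, arcTurn, tensorV, delta, h0, h1, h2, h3]
  | vertical =>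
    simp only [MidAligned, endWeight, ins, outs, e1, Finset.prod_range_succ,
      Finset.prod_range_zero, one_mul, add_zero]
    rcases e2 (a l) with h0 | h0 <;>
    rcases e2 (a (l + 1)) with h1 | h1 <;>
    rcases e2 (b l) with h2 | h2 <;>
    rcases e2 (b (l + 1)) with h3 | h3 <;>
    simp [otherEnd, IsAligned, box, Box.tensor, arcTurn, delta, h0, h1, h2, h3]
  | horizontal =>
    simp only [MidAligned, endWeight, ins, outs, e1, Finset.prod_range_succ,
      Finset.prod_range_zero, one_mul, add_zero]
    rcases e2 (a l) with h0 | h0 <;>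
    rcases e2 (a (l + 1)) with h1 | h1 <;>
    rcases e2 (b l) with h2 | h2 <;>
    rcases e2 (b (l + 1)) with h3 | h3 <;>
    simp [otherEnd, IsAligned, box, Box.tensor, arcTurn, Box.unitM, h0, h1, h2, h3]

open Classical in
/-- The tensor of a layer of a state vanishes unless the labels orient each arc, and then each
minimum or maximum contributes `u` to the power minus its turn. Although both ends of an arc occur
in the product, only the one where it starts has a weight. -/
theorem FlatPiece.layerTensor_eq_ite (P : FlatPiece) (l r : ℕ) (u : Rˣ) (a b : ℕ → Fin 2) :
    (P.box u).layerTensor l r a b =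
      if ∀ e, P.IsEnd l r e → (IsAligned a b (P.otherEnd l e) ↔ ¬ IsAligned a b e)
      then (((∏ j ∈ Finset.range (l + P.ins + r), P.endWeight l u a b ⟨false, j⟩) *
        ∏ j ∈ Finset.range (l + P.outs + r), P.endWeight l u a b ⟨true, j⟩ : Rˣ) : R)
      else 0 := by
  have hfin : ∀ x y : Fin 2, (x = 0 ↔ ¬ y = 1) ↔ x = y := by decide
  have hfin' : ∀ x y : Fin 2, (y = 1 ↔ ¬ x = 0) ↔ x = y := by decide
  have h1 : ∀ up, ∀ j ∈ Finset.range l, P.endWeight l u a b ⟨up, j⟩ = 1 := by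
    intro up j hj
    rw [endWeight, otherEnd_left _ _ _ (Finset.mem_range.1 hj), arcTurn_of_ne (by simp)]
    simp
  have h2 : ∀ j ∈ Finset.range r, P.endWeight l u a b ⟨false, l + P.ins + j⟩ = 1 := by
    intro j hj
    rw [endWeight, otherEnd_lower, arcTurn_of_ne (by simp)]
    simp
  have h3 : ∀ j ∈ Finset.range r, P.endWeight l u a b ⟨true, l + P.outs + j⟩ = 1 := by
    intro j hj
    rw [endWeight, otherEnd_upper, arcTurn_of_ne (by simp)]
    simp
  simp only [Finset.prod_range_add, Finset.prod_congr rfl (h1 _), Finset.prod_congr rfl h2,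
    Finset.prod_congr rfl h3, Finset.prod_const_one, one_mul, mul_one]
  rw [Box.layerTensor, prod_delta, prod_delta, tensor_eq_ite, box_ins, box_outs]
  have hiff : (∀ e, P.IsEnd l r e → (IsAligned a b (P.otherEnd l e) ↔ ¬ IsAligned a b e)) ↔
      (∀ j < l, a j = b j) ∧ (∀ j < r, a (l + P.ins + j) = b (l + P.outs + j)) ∧
        P.MidAligned l a b := by
    rw [forall_isEnd_iff]
    refine and_congr ?_ (and_congr ?_ Iff.rfl)
    · refine forall_congr' fun j => forall_congr' fun hj => ?_
      simp only [otherEnd_left _ _ _ hj]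
      simp only [IsAligned, Bool.not_false, Bool.not_true, if_true, Bool.false_eq_true, if_false,
        hfin, hfin', and_self]
    · refine forall_congr' fun j => forall_congr' fun hj => ?_
      simp only [otherEnd_lower, otherEnd_upper]
      simp only [IsAligned, if_true, Bool.false_eq_true, if_false, hfin, hfin', and_self]
  simp only [hiff]
  by_cases c1 : ∀ j < l, a j = b j
  · by_cases c2 : ∀ j < r, a (l + P.ins + j) = b (l + P.outs + j)
    · rw [if_pos c1, if_pos c2, one_mul, mul_one]
      by_cases c3 : P.MidAligned l a b
      · rw [if_pos c3, if_pos ⟨c1, c2, c3⟩]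
      · rw [if_neg c3, if_neg (c := _ ∧ _ ∧ _) (fun h => c3 h.2.2)]
    · rw [if_neg c2, if_neg (c := _ ∧ _ ∧ _) (fun h => c2 h.2.1), mul_zero]
  · rw [if_neg c1, if_neg (c := _ ∧ _ ∧ _) (fun h => c1 h.1), zero_mul, zero_mul]

end Labels
end FlatLayer

/-! ### The cycles of directed arcs -/

namespace Diagram
variable {K : Diagram}

lemma Dart.raw_injective : Function.Injective (Dart.raw : K.Dart → RawDart) := by
  rintro ⟨k, p | p⟩ ⟨k', p' | p'⟩ h <;>
  · simp only [Dart.raw, RawDart.mk.injEq, ArcEnd.mk.injEq, true_and, reduceCtorEq, false_and,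
      and_false] at h
    try
      obtain ⟨h1, h2⟩ := h
      obtain rfl := Fin.ext h1
      rw [Fin.ext h2]

lemma exists_raw_eq_iff (z : RawDart) : (∃ y : K.Dart, y.raw = z) ↔
    z.layer < K.size ∧
      z.start.pos < K.width (if z.start.upper = true then z.layer + 1 else z.layer) := by
  constructor
  · rintro ⟨⟨k, p | p⟩, rfl⟩
    · refine ⟨k.2, ?_⟩
      exact p.2.trans_eq (K.width_bot k).symm
    · refine ⟨k.2, ?_⟩
      exact p.2.trans_eq (K.width_top k).symm
  · rcases z with ⟨k, _ | _, p⟩ <;> rintro ⟨hk, hp⟩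
    · refine ⟨⟨⟨k, hk⟩, .inl ⟨p, ?_⟩⟩, rfl⟩
      rw [← width_bot]
      simpa using hp
    · refine ⟨⟨⟨k, hk⟩, .inr ⟨p, ?_⟩⟩, rfl⟩
      rw [← width_top]
      simpa using hp

lemma flatPiece_ins_eq (S : K.State) (k : Fin K.size) :
    (K.flatPiece S k).ins = (K.layer k).piece.ins := by
  rw [← FlatPiece.box_ins (1 : ℤˣ), flatPiece_ins]

lemma flatPiece_outs_eq (S : K.State) (k : Fin K.size) :
    (K.flatPiece S k).outs = (K.layer k).piece.outs := by
  rw [← FlatPiece.box_outs (1 : ℤˣ), flatPiece_outs]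

lemma isEnd_iff (S : K.State) (k : Fin K.size) (e : ArcEnd) :
    (K.flatPiece S k).IsEnd (K.layer k).left (K.layer k).right e ↔
      e.pos < K.width (if e.upper = true then (k : ℕ) + 1 else k) := by
  unfold FlatPiece.IsEnd
  rw [flatPiece_ins_eq, flatPiece_outs_eq]
  split_ifs
  · rw [width_top]; rfl
  · rw [width_bot]; rfl

lemma otherEnd_eq (S : K.State) (k : Fin K.size) (e : ArcEnd) :
    K.otherEnd S k e = (K.flatPiece S k).otherEnd (K.layer k).left e := by
  simp [otherEnd]

lemma exists_raw_eq_iff_isEnd (S : K.State) (k : Fin K.size) (e : ArcEnd) :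
    (∃ y : K.Dart, y.raw = ⟨k, e⟩) ↔
      (K.flatPiece S k).IsEnd (K.layer k).left (K.layer k).right e := by
  rw [exists_raw_eq_iff, isEnd_iff]
  exact ⟨fun h => h.2, fun h => ⟨k.2, h⟩⟩

lemma Dart.raw_eq (x : K.Dart) : x.raw = ⟨x.1, x.raw.start⟩ := by
  rcases x with ⟨k, p | p⟩ <;> rfl

lemma Dart.isEnd (S : K.State) (x : K.Dart) :
    (K.flatPiece S x.1).IsEnd (K.layer x.1).left (K.layer x.1).right x.raw.start :=
  (exists_raw_eq_iff_isEnd S x.1 _).1 ⟨x, x.raw_eq⟩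

lemma Dart.layer_raw (x : K.Dart) : x.raw.layer = x.1 := by
  rcases x with ⟨k, p | p⟩ <;> rfl

lemma otherEnd_raw (S : K.State) (x : K.Dart) : K.otherEnd S x.raw.layer x.raw.start =
    (K.flatPiece S x.1).otherEnd (K.layer x.1).left x.raw.start := by
  rw [x.layer_raw, otherEnd_eq]

lemma exists_raw_eq_reverse (S : K.State) (x : K.Dart) :
    ∃ y : K.Dart, y.raw = K.reverse S x.raw := by
  rw [reverse, otherEnd_raw, x.layer_raw, exists_raw_eq_iff_isEnd S]
  exact FlatPiece.isEnd_otherEnd _ _ _ _ (x.isEnd S)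

/-- The same directed arc, run through backwards. -/
noncomputable def rev (S : K.State) (x : K.Dart) : K.Dart := (exists_raw_eq_reverse S x).choose

lemma raw_rev (S : K.State) (x : K.Dart) : (rev S x).raw = K.reverse S x.raw :=
  (exists_raw_eq_reverse S x).choose_spec

/-- The directed arc on the other side of a horizontal line, with the same start as `x`. -/
def flipRaw (x : RawDart) : RawDart :=
  if x.start.upper = true then ⟨x.layer + 1, ⟨false, x.start.pos⟩⟩
  else ⟨x.layer - 1, ⟨true, x.start.pos⟩⟩

lemma next_eq_flipRaw (S : K.State) (x : RawDart) : K.next S x = flipRaw (K.reverse S x) := rfl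

lemma layer_pos_of_lower (x : K.Dart) (h : x.raw.start.upper = false) : 0 < x.raw.layer := by
  have := (exists_raw_eq_iff x.raw).1 ⟨x, rfl⟩
  by_contra h0
  rw [h, show x.raw.layer = 0 by omega] at this
  simp [width] at this

lemma exists_raw_eq_flipRaw (x : K.Dart) : ∃ y : K.Dart, y.raw = flipRaw x.raw := by
  have h := (exists_raw_eq_iff x.raw).1 ⟨x, rfl⟩
  rw [exists_raw_eq_iff]
  unfold flipRaw
  cases hu : x.raw.start.upper
  · have h0 := layer_pos_of_lower x hu
    rw [hu] at h
    simp only [Bool.false_eq_true, if_false, if_true] at h ⊢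
    rw [Nat.sub_add_cancel h0]
    exact ⟨by omega, h.2⟩
  · rw [hu] at h
    simp only [if_true, Bool.false_eq_true, if_false] at h ⊢
    refine ⟨?_, h.2⟩
    rcases Nat.lt_or_ge (x.raw.layer + 1) K.size with h' | h'
    · exact h'
    · rw [show x.raw.layer + 1 = K.size by omega, width_size] at h
      omega

/-- `flipRaw` as a map of the directed arcs of `K`. -/
noncomputable def flip (x : K.Dart) : K.Dart := (exists_raw_eq_flipRaw x).choose

lemma raw_flip (x : K.Dart) : (flip x).raw = flipRaw x.raw := (exists_raw_eq_flipRaw x).choose_spec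

lemma flip_flip (x : K.Dart) : flip (flip x) = x := by
  apply Dart.raw_injective
  rw [raw_flip, raw_flip]
  have := layer_pos_of_lower x
  rcases hx : x.raw with ⟨k, _ | _, p⟩ <;> rw [hx] at this
  · simp only [forall_true_left] at this
    simp [flipRaw, Nat.sub_add_cancel this]
  · simp [flipRaw]

lemma rev_rev (S : K.State) (x : K.Dart) : rev S (rev S x) = x := by
  apply Dart.raw_injective
  rw [raw_rev, raw_rev, reverse, reverse, otherEnd_raw]
  conv_rhs => rw [x.raw_eq]
  simp only [RawDart.mk.injEq]
  rw [x.layer_raw, otherEnd_eq]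
  exact ⟨rfl, FlatPiece.otherEnd_otherEnd _ _ _ _ (x.isEnd S)⟩

lemma layer_flip_ne (x : K.Dart) : (flip x).raw.layer ≠ x.raw.layer := by
  rw [raw_flip]
  have := layer_pos_of_lower x
  unfold flipRaw
  split_ifs with h
  · simp
  · have := this (by simpa using h)
    simp only
    omega

lemma start_rev (S : K.State) (x : K.Dart) : (rev S x).raw.start =
    (K.flatPiece S x.1).otherEnd (K.layer x.1).left x.raw.start := by
  rw [raw_rev, reverse, otherEnd_raw]

lemma pos_rev_ne (S : K.State) (x : K.Dart)
    (h : (rev S x).raw.start.upper = x.raw.start.upper) :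
    (rev S x).raw.start.pos ≠ x.raw.start.pos := by
  rw [start_rev] at *
  have := FlatPiece.pos_otherEnd_of_upper_eq _ _ _ _ (x.isEnd S) h
  omega

lemma rev_ne (S : K.State) (x : K.Dart) : rev S x ≠ x := fun h =>
  pos_rev_ne S x (by rw [h]) (by rw [h])

/-- Passing to the next arc of a curve. The product of the involutions `rev` and `flip`. -/
noncomputable def nextPerm (S : K.State) : Equiv.Perm K.Dart where
  toFun x := flip (rev S x)
  invFun x := rev S (flip x)
  left_inv x := by simp only [flip_flip, rev_rev]
  right_inv x := by simp only [flip_flip, rev_rev]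

lemma nextPerm_apply (S : K.State) (x : K.Dart) : nextPerm S x = flip (rev S x) := rfl

lemma raw_nextPerm (S : K.State) (x : K.Dart) : (nextPerm S x).raw = K.next S x.raw := by
  rw [nextPerm_apply, raw_flip, raw_rev, next_eq_flipRaw]

/-- The involution `rev` as a permutation. -/
noncomputable def revPerm (S : K.State) : Equiv.Perm K.Dart where
  toFun := rev S
  invFun := rev S
  left_inv := rev_rev S
  right_inv := rev_rev S

lemma rev_nextPerm_zpow (S : K.State) (n : ℤ) (x : K.Dart) :
    rev S ((nextPerm S ^ n) x) = (nextPerm S ^ (-n)) (rev S x) := by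
  have h : revPerm S * nextPerm S * (revPerm S)⁻¹ = (nextPerm S)⁻¹ := by
    ext1 y
    change rev S (flip (rev S (rev S y))) = rev S (flip y)
    rw [rev_rev]
  have h' := congrArg (fun σ => σ ^ n) h
  simp only [conj_zpow, inv_zpow, ← zpow_neg] at h'
  rw [← h']
  change _ = rev S ((nextPerm S ^ n) (rev S (rev S x)))
  rw [rev_rev]

lemma nextPerm_ne_rev (S : K.State) (x : K.Dart) : nextPerm S x ≠ rev S x := fun h =>
  layer_flip_ne (rev S x) (by rw [← nextPerm_apply, h])

/-- A curve does not run through an arc in both directions: the reversal would act on the cycle of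
`nextPerm` as a reflection, and a reflection of a cycle fixes an arc or a joint between two arcs.
Both are impossible. -/
theorem not_sameCycle_rev (S : K.State) (x : K.Dart) : ¬ (nextPerm S).SameCycle x (rev S x) := by
  rintro ⟨n, hn⟩
  -- The reflection takes step `m` to step `n - m`: for even `n` it fixes the arc at step `n / 2`,
  -- for odd `n` it exchanges two consecutive arcs.
  rcases Int.even_or_odd' n with ⟨m, rfl | rfl⟩
  · apply rev_ne S ((nextPerm S ^ m) x)
    rw [rev_nextPerm_zpow, ← hn, ← Equiv.Perm.mul_apply, ← zpow_add]
    congr 2; ring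
  · apply nextPerm_ne_rev S ((nextPerm S ^ m) x)
    rw [rev_nextPerm_zpow, ← hn, ← Equiv.Perm.mul_apply, ← Equiv.Perm.mul_apply, ← zpow_add,
      ← zpow_one_add]
    congr 2; ring

lemma sameCycle_rev_rev {S : K.State} {x y : K.Dart} (h : (nextPerm S).SameCycle x y) :
    (nextPerm S).SameCycle (rev S x) (rev S y) := by
  obtain ⟨n, rfl⟩ := h
  exact ⟨-n, (rev_nextPerm_zpow S n x).symm⟩

/-- The curve through a directed arc. -/
def Curve.mk (S : K.State) (x : K.Dart) : Curve S := Quot.mk _ x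

lemma Curve.mk_nextPerm (S : K.State) (x : K.Dart) :
    Curve.mk S (nextPerm S x) = Curve.mk S x :=
  Eq.symm <| Quot.sound <| show _ ∨ _ from Or.inl (raw_nextPerm S x)

lemma Curve.mk_rev (S : K.State) (x : K.Dart) : Curve.mk S (rev S x) = Curve.mk S x :=
  Eq.symm <| Quot.sound <| show _ ∨ _ from Or.inr (raw_rev S x)

/-- The directed arc at which `Curve.rot` starts to run through the curve. -/
noncomputable def Curve.base {S : K.State} (C : Curve S) : K.Dart := Quot.out C

lemma Curve.mk_base {S : K.State} (C : Curve S) : Curve.mk S C.base = C := Quot.out_eq C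

lemma Curve.mk_eq_of_sameCycle {S : K.State} {x y : K.Dart} (h : (nextPerm S).SameCycle x y) :
    Curve.mk S x = Curve.mk S y := by
  obtain ⟨n, rfl⟩ := h.exists_nat_pow_eq
  induction n with
  | zero => rfl
  | succ n ih =>
    rw [pow_succ', Equiv.Perm.mul_apply, Curve.mk_nextPerm]
    exact ih ⟨n, rfl⟩

/-- A curve consists of one cycle of `nextPerm` and its reversal. -/
theorem Curve.mk_eq_mk_iff {S : K.State} {x y : K.Dart} : Curve.mk S x = Curve.mk S y ↔
    (nextPerm S).SameCycle x y ∨ (nextPerm S).SameCycle (rev S x) y := by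
  constructor
  · intro h
    have h' := Quot.eqvGen_exact h
    clear h
    induction h' with
    | rel a b h =>
      rcases h with h | h
      · left
        rw [← raw_nextPerm] at h
        rw [Dart.raw_injective h]
        exact ⟨1, rfl⟩
      · right
        rw [← raw_rev] at h
        rw [Dart.raw_injective h]
    | refl a => exact Or.inl (Equiv.Perm.SameCycle.refl _ _)
    | symm a b _ ih =>
      rcases ih with ih | ih
      · exact Or.inl ih.symm
      · right
        have := sameCycle_rev_rev ih
        rw [rev_rev] at this
        exact this.symm
    | trans a b c _ _ ih ih' =>
      rcases ih with ih | ih <;> rcases ih' with ih' | ih'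
      · exact Or.inl (ih.trans ih')
      · exact Or.inr ((sameCycle_rev_rev ih).trans ih')
      · exact Or.inr (ih.trans ih')
      · have := sameCycle_rev_rev ih
        rw [rev_rev] at this
        exact Or.inl (this.trans ih')
  · rintro (h | h)
    · exact Curve.mk_eq_of_sameCycle h
    · rw [← Curve.mk_rev]
      exact Curve.mk_eq_of_sameCycle h

end Diagram

/-! ### Coherent labelings and the state sum -/

namespace Diagram
variable {K : Diagram}

lemma fst_rev (S : K.State) (x : K.Dart) : (rev S x).1 = x.1 := by
  apply Fin.ext
  rw [← Dart.layer_raw, raw_rev, ← Dart.layer_raw]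
  rfl

/-- The labeling `s`, read as in `IsAligned`, directs the arc away from its start. -/
def IsAlignedDart (s : K.Point → Fin 2) (x : K.Dart) : Prop :=
  IsAligned (K.indexAt s x.1) (K.indexAt s (x.1 + 1)) x.raw.start

/-- The number of counterclockwise half turns of a directed arc. -/
noncomputable def dartTurn (S : K.State) (x : K.Dart) : ℤ :=
  arcTurn x.raw.start (rev S x).raw.start

lemma dartTurn_rev (S : K.State) (x : K.Dart) : dartTurn S (rev S x) = -dartTurn S x := by
  rw [dartTurn, dartTurn, rev_rev]
  exact arcTurn_symm (pos_rev_ne S x)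

lemma isAlignedDart_rev (S : K.State) (s : K.Point → Fin 2) (x : K.Dart) :
    IsAlignedDart s (rev S x) ↔ IsAligned (K.indexAt s x.1) (K.indexAt s (x.1 + 1))
      ((K.flatPiece S x.1).otherEnd (K.layer x.1).left x.raw.start) := by
  rw [IsAlignedDart, fst_rev, start_rev]

lemma isAlignedDart_iff (s : K.Point → Fin 2) (x : K.Dart) : IsAlignedDart s x ↔
    K.indexAt s (if x.raw.start.upper = true then x.raw.layer + 1 else x.raw.layer)
      x.raw.start.pos = if x.raw.start.upper = true then 1 else 0 := by
  rw [IsAlignedDart, IsAligned, x.layer_raw]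
  split_ifs <;> rfl

/-- The two arcs that meet at a point are directed through it: one of them starts there and the
other ends there. -/
lemma isAlignedDart_flip (s : K.Point → Fin 2) (x : K.Dart) :
    IsAlignedDart s (flip x) ↔ ¬ IsAlignedDart s x := by
  rw [isAlignedDart_iff, isAlignedDart_iff, raw_flip]
  have h := layer_pos_of_lower x
  have e : ∀ z : Fin 2, (z = 0 ↔ ¬ z = 1) ∧ (z = 1 ↔ ¬ z = 0) := by decide
  unfold flipRaw
  cases hu : x.raw.start.upper
  · simp only [Bool.false_eq_true, if_false, if_true, Nat.sub_add_cancel (h hu)]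
    exact (e _).2
  · simp only [if_true, Bool.false_eq_true, if_false]
    exact (e _).1

/-- The labeling directs every arc of the state, that is, away from exactly one of its ends. -/
def IsCoherent (S : K.State) (s : K.Point → Fin 2) : Prop :=
  ∀ x : K.Dart, IsAlignedDart s (rev S x) ↔ ¬ IsAlignedDart s x

open Classical in
/-- The weight of a labeling of a state: `0` if the labeling is not coherent, otherwise a product
over the arcs, directed as the labeling says. -/
theorem prod_stateTensor {R : Type*} [CommRing R] (u : Rˣ) (S : K.State) (s : K.Point → Fin 2) :
    ∏ k : Fin K.size, K.stateTensor u S k (K.indexAt s k) (K.indexAt s (k + 1)) =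
      if IsCoherent S s then
        ((∏ x : K.Dart, if IsAlignedDart s x then u ^ (-dartTurn S x) else 1 : Rˣ) : R)
      else 0 := by
  simp only [stateTensor, FlatPiece.layerTensor_eq_ite]
  rw [Finset.prod_ite_zero]
  have hiff : (∀ k ∈ (Finset.univ : Finset (Fin K.size)), ∀ e,
      (K.flatPiece S k).IsEnd (K.layer k).left (K.layer k).right e →
        (IsAligned (K.indexAt s k) (K.indexAt s (k + 1))
          ((K.flatPiece S k).otherEnd (K.layer k).left e) ↔
            ¬ IsAligned (K.indexAt s k) (K.indexAt s (k + 1)) e)) ↔ IsCoherent S s := by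
    constructor
    · intro h x
      rw [isAlignedDart_rev]
      exact h x.1 (Finset.mem_univ _) _ (x.isEnd S)
    · intro h k _ e he
      obtain ⟨x, hx⟩ := (exists_raw_eq_iff_isEnd S k e).2 he
      have hk : x.1 = k := Fin.ext (by rw [← x.layer_raw, hx])
      have := h x
      rw [isAlignedDart_rev, IsAlignedDart, hk, hx] at this
      exact this
  simp only [hiff]
  congr 1
  rw [← Units.coe_prod, Fintype.prod_sigma]
  congr 1
  refine Finset.prod_congr rfl fun k _ => ?_
  rw [Fintype.prod_sum_type, flatPiece_ins_eq, flatPiece_outs_eq]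
  have hw : ∀ x : K.Dart, (if IsAlignedDart s x then u ^ (-dartTurn S x) else 1) =
      (K.flatPiece S x.1).endWeight (K.layer x.1).left u (K.indexAt s x.1)
        (K.indexAt s (x.1 + 1)) x.raw.start := fun x => by
    rw [FlatPiece.endWeight, dartTurn, start_rev]
    exact if_congr Iff.rfl rfl rfl
  simp only [hw]
  congr 1
  · exact Finset.prod_range (n := (K.layer k).bot) _
  · exact Finset.prod_range (n := (K.layer k).top) _

section Coherent
variable {S : K.State} {s : K.Point → Fin 2}

lemma IsCoherent.nextPerm (h : IsCoherent S s) (x : K.Dart) :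
    IsAlignedDart s (nextPerm S x) ↔ IsAlignedDart s x := by
  rw [nextPerm_apply, isAlignedDart_flip, h x, not_not]

lemma IsCoherent.sameCycle (h : IsCoherent S s) {x y : K.Dart}
    (hxy : (Diagram.nextPerm S).SameCycle x y) : IsAlignedDart s x ↔ IsAlignedDart s y := by
  obtain ⟨n, rfl⟩ := hxy.exists_nat_pow_eq
  clear hxy
  induction n with
  | zero => rfl
  | succ n ih =>
    rw [pow_succ', Equiv.Perm.mul_apply, h.nextPerm]
    exact ih

/-- Every directed arc runs along the chosen direction of its curve or against it. -/
lemma sameCycle_base (S : K.State) (x : K.Dart) :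
    (Diagram.nextPerm S).SameCycle (Curve.mk S x).base (rev S x) ↔
      ¬ (Diagram.nextPerm S).SameCycle (Curve.mk S x).base x := by
  constructor
  · intro h h'
    exact not_sameCycle_rev S x (h'.symm.trans h)
  · intro h
    have := Curve.mk_eq_mk_iff.1 (Curve.mk_base (Curve.mk S x))
    have := sameCycle_rev_rev (this.resolve_left h)
    rwa [rev_rev] at this

lemma IsCoherent.isAlignedDart_iff_base (h : IsCoherent S s) (x : K.Dart) :
    IsAlignedDart s x ↔ ((Diagram.nextPerm S).SameCycle (Curve.mk S x).base x ↔
      IsAlignedDart s (Curve.mk S x).base) := by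
  by_cases hx : (Diagram.nextPerm S).SameCycle (Curve.mk S x).base x
  · rw [h.sameCycle hx]
    simp [hx]
  · have := h.sameCycle ((sameCycle_base S x).2 hx)
    rw [this, h x]
    simp [hx]

lemma exists_lower_dart (q : K.Point) :
    ∃ x : K.Dart, x.raw = ⟨q.1, ⟨false, q.2⟩⟩ := by
  rw [exists_raw_eq_iff]
  refine ⟨?_, by simp⟩
  rcases Nat.lt_or_ge q.1 K.size with h | h
  · exact h
  · have h2 : K.width q.1 = 0 := by
      rw [show (q.1 : ℕ) = K.size by omega, width_size]
    exact absurd (q.2.2.trans_eq h2) (Nat.not_lt_zero _)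

lemma isAlignedDart_lower (s : K.Point → Fin 2) (q : K.Point) (x : K.Dart)
    (hx : x.raw = ⟨q.1, ⟨false, q.2⟩⟩) : IsAlignedDart s x ↔ s q = 0 := by
  rw [isAlignedDart_iff, hx]
  simp only [Bool.false_eq_true, if_false]
  rw [indexAt, dif_pos q.1.2, dif_pos q.2.2]

lemma eq_of_isAlignedDart_iff {s s' : K.Point → Fin 2}
    (h : ∀ x : K.Dart, IsAlignedDart s x ↔ IsAlignedDart s' x) : s = s' := by
  funext q
  obtain ⟨x, hx⟩ := exists_lower_dart q
  have := h x
  rw [isAlignedDart_lower s q x hx, isAlignedDart_lower s' q x hx] at this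
  revert this
  generalize s q = a, s' q = b
  revert a b
  decide

/-- Every choice of directions of the curves, given by a Boolean for each curve, comes from a
coherent labeling. -/
theorem exists_isCoherent (S : K.State) (o : Curve S → Bool) :
    ∃ s : K.Point → Fin 2, IsCoherent S s ∧ ∀ C : Curve S,
      IsAlignedDart s C.base ↔ o C = true := by
  classical
  -- `σ x` says that the chosen direction of the curve through `x` agrees with that of `x`.
  let σ : K.Dart → Prop := fun x =>
    (Diagram.nextPerm S).SameCycle (Curve.mk S x).base x ↔ o (Curve.mk S x) = true
  have hrev : ∀ x, σ (rev S x) ↔ ¬ σ x := fun x => by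
    simp only [σ, Curve.mk_rev, sameCycle_base]
    tauto
  have hnext : ∀ x, σ (Diagram.nextPerm S x) ↔ σ x := fun x => by
    simp only [σ, Curve.mk_nextPerm, Equiv.Perm.sameCycle_apply_right]
  have hflip : ∀ x, σ (flip x) ↔ ¬ σ x := fun x => by
    rw [← hrev, ← hnext (rev S x), nextPerm_apply, rev_rev]
  let s : K.Point → Fin 2 := fun q => if σ (exists_lower_dart q).choose then 0 else 1
  have hs : ∀ x, IsAlignedDart s x ↔ σ x := by
    have hlow : ∀ x : K.Dart, x.raw.start.upper = false → (IsAlignedDart s x ↔ σ x) := by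
      intro x hx
      have hx' := (exists_raw_eq_iff x.raw).1 ⟨x, rfl⟩
      rw [hx] at hx'
      let q : K.Point := ⟨⟨x.raw.layer, by omega⟩, ⟨x.raw.start.pos, hx'.2⟩⟩
      have hq : x.raw = ⟨q.1, ⟨false, q.2⟩⟩ := by
        rcases hr : x.raw with ⟨k, up, p⟩
        rw [hr] at hx
        simp only at hx
        simp [q, hr, hx]
      rw [isAlignedDart_lower s q x hq]
      have : (exists_lower_dart q).choose = x :=
        Dart.raw_injective ((exists_lower_dart q).choose_spec.trans hq.symm)
      simp only [s, this]
      split_ifs with h <;> simp [h]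
    intro x
    cases hx : x.raw.start.upper
    · exact hlow x hx
    · have h1 := hlow (flip x) (by rw [raw_flip, flipRaw, if_pos hx])
      rw [isAlignedDart_flip, hflip] at h1
      exact not_iff_not.1 h1
  refine ⟨s, fun x => by rw [hs, hs, hrev], fun C => ?_⟩
  rw [hs]
  simp only [σ, Curve.mk_base, Equiv.Perm.SameCycle.refl, true_iff]

end Coherent

open Classical in
/-- The number of counterclockwise half turns along the curve that starts with `x`. -/
noncomputable def cycleTurn (S : K.State) (x : K.Dart) : ℤ :=
  ∑ y : K.Dart with (nextPerm S).SameCycle x y, dartTurn S y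

lemma cycleTurn_rev (S : K.State) (x : K.Dart) : cycleTurn S (rev S x) = -cycleTurn S x := by
  classical
  rw [cycleTurn, cycleTurn, ← Finset.sum_neg_distrib]
  refine Finset.sum_bij' (fun y _ => rev S y) (fun y _ => rev S y) ?_ ?_ ?_ ?_ ?_
  · intro y hy
    simp only [Finset.mem_filter, Finset.mem_univ, true_and] at hy ⊢
    have := sameCycle_rev_rev hy
    rwa [rev_rev] at this
  · intro y hy
    simp only [Finset.mem_filter, Finset.mem_univ, true_and] at hy ⊢
    exact sameCycle_rev_rev hy
  · exact fun y _ => rev_rev S y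
  · exact fun y _ => rev_rev S y
  · intro y _
    rw [dartTurn_rev, neg_neg]

lemma prod_zpow_eq_zpow_sum {ι G : Type*} [CommGroup G] (t : Finset ι) (f : ι → ℤ) (u : G) :
    ∏ j ∈ t, u ^ f j = u ^ ∑ j ∈ t, f j := by
  classical
  induction t using Finset.induction_on with
  | empty => simp
  | insert a t ha ih => rw [Finset.prod_insert ha, Finset.sum_insert ha, zpow_add, ih]

open Classical in
/-- A coherent labeling gives each curve the weight `u ^ (-t)`, where `t` is the number of half
turns in the direction of the labeling. -/
lemma IsCoherent.prod_curve {G : Type*} [CommGroup G] (u : G) {S : K.State}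
    {s : K.Point → Fin 2} (h : IsCoherent S s) (C : Curve S) :
    (∏ x : K.Dart with Curve.mk S x = C,
        if IsAlignedDart s x then u ^ (-dartTurn S x) else 1) =
      if IsAlignedDart s C.base then u ^ (-cycleTurn S C.base)
      else u ^ cycleTurn S C.base := by
  have key : ∀ y : K.Dart, Curve.mk S y = C → IsAlignedDart s y →
      (∏ x : K.Dart with Curve.mk S x = C,
        if IsAlignedDart s x then u ^ (-dartTurn S x) else 1) = u ^ (-cycleTurn S y) := by
    intro y hy hya
    rw [← Finset.prod_filter, Finset.filter_filter, prod_zpow_eq_zpow_sum, cycleTurn,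
      ← Finset.sum_neg_distrib]
    congr 2
    ext x
    simp only [Finset.mem_filter, Finset.mem_univ, true_and]
    constructor
    · rintro ⟨h1, h2⟩
      refine (Curve.mk_eq_mk_iff.1 (hy.trans h1.symm)).resolve_right fun h3 => ?_
      exact (h y).1 ((h.sameCycle h3).2 h2) hya
    · exact fun hx => ⟨(Curve.mk_eq_of_sameCycle hx).symm.trans hy, (h.sameCycle hx).1 hya⟩
  split_ifs with hC
  · exact key _ (Curve.mk_base C) hC
  · rw [key (rev S C.base) (by rw [Curve.mk_rev, Curve.mk_base]) ((h _).2 hC), cycleTurn_rev,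
      neg_neg]

/-- The coherent labelings are in bijection with the choices of directions of the curves, so their
sum factors over the curves. -/
theorem stateSum_eq_prod {R : Type*} [CommRing R] (u : Rˣ) (S : K.State) :
    K.stateSum u S = ∏ C : Curve S, (((u ^ cycleTurn S C.base : Rˣ) : R) +
      ((u ^ (-cycleTurn S C.base) : Rˣ) : R)) := by
  classical
  have hprod : ∏ C : Curve S, (((u ^ cycleTurn S C.base : Rˣ) : R) +
      ((u ^ (-cycleTurn S C.base) : Rˣ) : R)) = ∑ o : Curve S → Bool, ∏ C : Curve S,
        ((if o C = true then u ^ (-cycleTurn S C.base)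
          else u ^ cycleTurn S C.base : Rˣ) : R) := by
    have h := Finset.prod_univ_sum (fun _ : Curve S => (Finset.univ : Finset Bool))
      (fun C b => ((if b = true then u ^ (-cycleTurn S C.base)
        else u ^ cycleTurn S C.base : Rˣ) : R))
    rw [Fintype.piFinset_univ] at h
    rw [← h]
    refine Finset.prod_congr rfl fun C _ => ?_
    simp [add_comm]
  rw [hprod, stateSum]
  simp only [prod_stateTensor]
  rw [← Finset.sum_filter]
  refine Finset.sum_bij (fun s _ C => decide (IsAlignedDart s C.base)) ?_ ?_ ?_ ?_
  · exact fun _ _ => Finset.mem_univ _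
  · intro s hs s' hs' h
    simp only [Finset.mem_filter, Finset.mem_univ, true_and] at hs hs'
    refine eq_of_isAlignedDart_iff fun x => ?_
    rw [hs.isAlignedDart_iff_base, hs'.isAlignedDart_iff_base,
      decide_eq_decide.1 (congrFun h (Curve.mk S x))]
  · intro o _
    obtain ⟨s, hs, ho⟩ := exists_isCoherent S o
    refine ⟨s, by simpa using hs, ?_⟩
    funext C
    rw [Bool.eq_iff_iff, decide_eq_true_iff, ho]
  · intro s hs
    simp only [Finset.mem_filter, Finset.mem_univ, true_and] at hs
    rw [← Units.coe_prod, ← Finset.prod_fiberwise _ (Curve.mk S)]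
    congr 1
    refine Finset.prod_congr rfl fun C _ => ?_
    rw [hs.prod_curve u C]
    simp only [decide_eq_true_iff]

end Diagram

/-! ### Tangent angles of glued arcs -/

section Glue

/-- The function which is `f n`, shifted by `n`, on the interval `[n, n + 1)`. -/
noncomputable def glue {E : Type*} (f : ℤ → ℝ → E) (t : ℝ) : E := f ⌊t⌋ (Int.fract t)

lemma glue_of_mem_Ico {E : Type*} (f : ℤ → ℝ → E) {n : ℤ} {t : ℝ}
    (ht : t ∈ Set.Ico (n : ℝ) (n + 1)) : glue f t = f n (t - n) := by
  have : ⌊t⌋ = n := Int.floor_eq_iff.2 ht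
  rw [glue, Int.fract, this]

lemma glue_of_mem_Ioc {E : Type*} {f : ℤ → ℝ → E} (hf : ∀ n, f n 1 = f (n + 1) 0) {n : ℤ} {t : ℝ}
    (ht : t ∈ Set.Ioc (n : ℝ) (n + 1)) : glue f t = f n (t - n) := by
  rcases ht.2.lt_or_eq with h | h
  · exact glue_of_mem_Ico f ⟨ht.1.le, h⟩
  · rw [glue_of_mem_Ico f (n := n + 1) (by rw [h]; push_cast; constructor <;> linarith), h]
    push_cast
    rw [sub_self, add_sub_cancel_left, hf]

lemma mem_Ioc_ceil_sub_one (t : ℝ) : t ∈ Set.Ioc ((⌈t⌉ - 1 : ℤ) : ℝ) ((⌈t⌉ - 1 : ℤ) + 1) := by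
  have := Int.ceil_lt_add_one t
  have := Int.le_ceil t
  constructor <;> push_cast <;> linarith

lemma glue_eventuallyEq_right {E : Type*} (f : ℤ → ℝ → E) (t : ℝ) :
    glue f =ᶠ[nhdsWithin t (Set.Ici t)] fun r => f ⌊t⌋ (r - ⌊t⌋) := by
  filter_upwards [Ico_mem_nhdsGE (Int.lt_floor_add_one t)] with r hr
  exact glue_of_mem_Ico f ⟨(Int.floor_le t).trans hr.1, hr.2⟩

/-- To the left of `t`, the piece with the number `⌈t⌉ - 1` counts. It differs from `⌊t⌋` if `t` is
an integer. -/
lemma glue_eventuallyEq_left {E : Type*} {f : ℤ → ℝ → E} (hf : ∀ n, f n 1 = f (n + 1) 0) (t : ℝ) :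
    glue f =ᶠ[nhdsWithin t (Set.Iic t)] fun r => f (⌈t⌉ - 1) (r - (⌈t⌉ - 1 : ℤ)) := by
  filter_upwards [Ioc_mem_nhdsLE (mem_Ioc_ceil_sub_one t).1] with r hr
  exact glue_of_mem_Ioc hf ⟨hr.1, hr.2.trans (mem_Ioc_ceil_sub_one t).2⟩

theorem continuous_glue {E : Type*} [TopologicalSpace E] {f : ℤ → ℝ → E}
    (hc : ∀ n, Continuous (f n)) (hf : ∀ n, f n 1 = f (n + 1) 0) : Continuous (glue f) := by
  rw [continuous_iff_continuousAt]
  intro t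
  rw [continuousAt_iff_continuous_left_right]
  constructor
  · refine ContinuousWithinAt.congr_of_eventuallyEq ?_ (glue_eventuallyEq_left hf t)
      (glue_of_mem_Ioc hf (mem_Ioc_ceil_sub_one t))
    exact ((hc _).comp (continuous_id.sub continuous_const)).continuousWithinAt
  · refine ContinuousWithinAt.congr_of_eventuallyEq ?_ (glue_eventuallyEq_right f t) rfl
    exact ((hc _).comp (continuous_id.sub continuous_const)).continuousWithinAt

theorem hasDerivAt_glue {E : Type*} [NormedAddCommGroup E] [NormedSpace ℝ E] {f v : ℤ → ℝ → E}
    (hd : ∀ n t, HasDerivAt (f n) (v n t) t) (hf : ∀ n, f n 1 = f (n + 1) 0)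
    (hv : ∀ n, v n 1 = v (n + 1) 0) (t : ℝ) : HasDerivAt (glue f) (glue v t) t := by
  rw [← hasDerivWithinAt_univ, ← Set.Iic_union_Ici (a := t)]
  refine HasDerivWithinAt.union ?_ ?_
  · refine HasDerivWithinAt.congr_of_eventuallyEq ?_ (glue_eventuallyEq_left hf t)
      (glue_of_mem_Ioc hf (mem_Ioc_ceil_sub_one t))
    rw [glue_of_mem_Ioc hv (mem_Ioc_ceil_sub_one t)]
    exact ((hd _ _).comp_sub_const t _).hasDerivWithinAt
  · refine HasDerivWithinAt.congr_of_eventuallyEq ?_ (glue_eventuallyEq_right f t) rfl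
    exact ((hd _ _).comp_sub_const t _).hasDerivWithinAt

end Glue

section TangentAngle

/-- Two tangent angles of the same curve differ by a constant, since their difference is a
continuous function with values in `2πℤ`. -/
theorem IsTangentAngle.sub_eq {γ : ℝ → ℂ} {θ θ' : ℝ → ℝ} (h : IsTangentAngle γ θ)
    (h' : IsTangentAngle γ θ') (a b : ℝ) : θ a - θ b = θ' a - θ' b := by
  have key : ∀ t, ∃ n : ℤ, θ t = θ' t + n * (2 * Real.pi) := by
    intro t
    obtain ⟨-, hne, h1⟩ := h.2 t
    obtain ⟨-, -, h2⟩ := h'.2 t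
    have hn : ((‖deriv γ t‖ : ℝ) : ℂ) ≠ 0 := by
      rw [Complex.ofReal_ne_zero]; exact norm_ne_zero_iff.2 hne
    have he : Complex.exp (θ t * Complex.I) = Complex.exp (θ' t * Complex.I) :=
      mul_left_cancel₀ hn (h1.symm.trans h2)
    obtain ⟨n, hn⟩ := Complex.exp_eq_exp_iff_exists_int.1 he
    refine ⟨n, ?_⟩
    have h3 : ((θ t : ℝ) : ℂ) = ((θ' t + n * (2 * Real.pi) : ℝ) : ℂ) := by
      apply mul_right_cancel₀ Complex.I_ne_zero
      rw [hn]; push_cast; ring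
    exact_mod_cast h3
  choose n hn using key
  have hpi := Real.pi_pos
  have hcont : Continuous n := by
    rw [Int.isClosedEmbedding_coe_real.isEmbedding.continuous_iff]
    have : ((↑) : ℤ → ℝ) ∘ n = fun t => (θ t - θ' t) / (2 * Real.pi) := by
      funext t
      simp only [Function.comp_apply, hn t]
      field_simp
      ring
    rw [this]
    exact (h.1.sub h'.1).div_const _
  have hab : n a = n b := PreconnectedSpace.constant inferInstance hcont
  rw [hn a, hn b, hab]
  ring

theorem whitneyDegree_eq {γ : ℝ → ℂ} {θ : ℝ → ℝ} {T : ℝ} {n : ℤ} (h : IsTangentAngle γ θ)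
    (hn : θ T - θ 0 = 2 * Real.pi * n) : whitneyDegree γ T = n := by
  have hex : ∃ n : ℤ, ∃ θ : ℝ → ℝ, IsTangentAngle γ θ ∧ θ T - θ 0 = 2 * Real.pi * n :=
    ⟨n, θ, h, hn⟩
  rw [whitneyDegree, dif_pos hex]
  obtain ⟨θ', h', hn'⟩ := hex.choose_spec
  have := h'.sub_eq h T 0
  rw [hn, hn'] at this
  exact_mod_cast mul_left_cancel₀ (by positivity) this

end TangentAngle

section Arc

lemma hasDerivAt_mk {f g : ℝ → ℝ} {f' g' t : ℝ} (hf : HasDerivAt f f' t)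
    (hg : HasDerivAt g g' t) : HasDerivAt (fun r => (⟨f r, g r⟩ : ℂ)) ⟨f', g'⟩ t := by
  simp only [Complex.mk_eq_add_mul_I]
  exact hf.ofReal_comp.add (hg.ofReal_comp.mul_const _)

/-- The velocity of `arcPath`. -/
noncomputable def arcVelocity (e e' : ArcEnd) (t : ℝ) : ℂ :=
  let x : ℝ := e.pos
  let x' : ℝ := e'.pos
  match e.upper, e'.upper with
  | false, true => ⟨(x' - x) * (6 * t - 6 * t ^ 2), 1⟩
  | true, false => ⟨(x' - x) * (6 * t - 6 * t ^ 2), -1⟩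
  | false, false => ⟨(x' - x) / 2 * Real.pi * Real.sin (Real.pi * t), Real.cos (Real.pi * t)⟩
  | true, true => ⟨(x' - x) / 2 * Real.pi * Real.sin (Real.pi * t), -Real.cos (Real.pi * t)⟩

theorem hasDerivAt_arcPath (k : ℕ) (e e' : ArcEnd) (t : ℝ) :
    HasDerivAt (arcPath k e e') (arcVelocity e e' t) t := by
  have hpi : HasDerivAt (fun r => Real.pi * r) Real.pi t := by
    simpa using (hasDerivAt_id t).const_mul Real.pi
  have hthrough : HasDerivAt (fun r : ℝ => (e.pos : ℝ) + (e'.pos - e.pos) * (3 * r ^ 2 - 2 * r ^ 3))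
      ((e'.pos - e.pos) * (6 * t - 6 * t ^ 2)) t := by
    have := (((((hasDerivAt_id t).pow 2).const_mul 3).sub
      (((hasDerivAt_id t).pow 3).const_mul 2)).const_mul
      ((e'.pos : ℝ) - e.pos)).const_add (e.pos : ℝ)
    refine this.congr_deriv ?_
    simp only [id, Nat.cast_ofNat, mul_one, Nat.reduceSub, pow_one]
    ring
  have hturn : HasDerivAt (fun r : ℝ => ((e.pos : ℝ) + e'.pos) / 2 +
      (e.pos - e'.pos) / 2 * Real.cos (Real.pi * r))
      ((e'.pos - e.pos) / 2 * Real.pi * Real.sin (Real.pi * t)) t := by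
    refine ((hpi.cos.const_mul (((e.pos : ℝ) - e'.pos) / 2)).const_add
      (((e.pos : ℝ) + e'.pos) / 2)).congr_deriv ?_
    ring
  have hbump : HasDerivAt (fun r : ℝ => Real.sin (Real.pi * r) / Real.pi)
      (Real.cos (Real.pi * t)) t := by
    refine (hpi.sin.div_const Real.pi).congr_deriv ?_
    field_simp
  rcases e with ⟨_ | _, p⟩ <;> rcases e' with ⟨_ | _, p'⟩
  · exact hasDerivAt_mk hturn (hbump.const_add _)
  · exact hasDerivAt_mk hthrough ((hasDerivAt_id t).const_add _)
  · exact hasDerivAt_mk hthrough ((hasDerivAt_id t).const_sub _)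
  · exact hasDerivAt_mk hturn (hbump.const_sub _)

/-- The velocity with which an arc leaves its end `e`: up from the lower and down from the upper
line. -/
noncomputable def startDir (e : ArcEnd) : ℂ := if e.upper = true then -Complex.I else Complex.I

/-- The point of the plane at which the end `e` of an arc in the `k`-th layer lies. -/
def endPoint (k : ℕ) (e : ArcEnd) : ℂ := ⟨e.pos, if e.upper = true then k + 1 else k⟩

lemma arcPath_zero (k : ℕ) (e e' : ArcEnd) : arcPath k e e' 0 = endPoint k e := by
  rcases e with ⟨_ | _, p⟩ <;> rcases e' with ⟨_ | _, p'⟩ <;>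
    simp [arcPath, endPoint, Complex.ext_iff] <;> ring

lemma arcPath_one (k : ℕ) (e e' : ArcEnd) : arcPath k e e' 1 = endPoint k e' := by
  rcases e with ⟨_ | _, p⟩ <;> rcases e' with ⟨_ | _, p'⟩ <;>
    simp [arcPath, endPoint, Complex.ext_iff] <;> ring

lemma arcVelocity_zero (e e' : ArcEnd) : arcVelocity e e' 0 = startDir e := by
  rcases e with ⟨_ | _, p⟩ <;> rcases e' with ⟨_ | _, p'⟩ <;>
    simp [arcVelocity, startDir, Complex.ext_iff]

lemma arcVelocity_one (e e' : ArcEnd) : arcVelocity e e' 1 = -startDir e' := by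
  rcases e with ⟨_ | _, p⟩ <;> rcases e' with ⟨_ | _, p'⟩ <;>
    simp [arcVelocity, startDir, Complex.ext_iff]

/-- The velocity of an arc relative to its initial velocity, after a uniform rotation by the total
turn of the arc has been removed. -/
noncomputable def arcResidue (e e' : ArcEnd) (t : ℝ) : ℂ :=
  arcVelocity e e' t / startDir e * Complex.exp (-(Real.pi * arcTurn e e' * t : ℝ) * Complex.I)

lemma startDir_ne_zero (e : ArcEnd) : startDir e ≠ 0 := by
  unfold startDir; split_ifs <;> simp

lemma norm_startDir (e : ArcEnd) : ‖startDir e‖ = 1 := by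
  unfold startDir; split_ifs <;> simp

/-- Along an arc, the direction turns by `π` times `arcTurn`, modulo `2π`. -/
lemma neg_startDir (e e' : ArcEnd) :
    -startDir e' = startDir e * Complex.exp ((Real.pi * arcTurn e e' : ℝ) * Complex.I) := by
  have h1 : Complex.exp (-(Real.pi * Complex.I)) = -1 := by
    rw [Complex.exp_neg, Complex.exp_pi_mul_I]; norm_num
  rcases e with ⟨_ | _, p⟩ <;> rcases e' with ⟨_ | _, p'⟩ <;>
    simp [startDir, arcTurn] <;> split_ifs <;> simp [h1]

/-- Along every arc, the direction stays within a right angle of the uniform rotation. Hence the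
argument of the residue is continuous, and the total turn of the arc is that of the rotation. -/
theorem arcResidue_re_pos (e e' : ArcEnd)
    (h : e'.upper = e.upper → e'.pos = e.pos + 1 ∨ e.pos = e'.pos + 1) (t : ℝ) :
    0 < (arcResidue e e' t).re := by
  have hcs := Real.sin_sq_add_cos_sq (Real.pi * t)
  have hpi := Real.pi_gt_three
  have hpos : 0 < Real.cos (Real.pi * t) ^ 2 + Real.pi / 2 * Real.sin (Real.pi * t) ^ 2 := by
    nlinarith [sq_nonneg (Real.sin (Real.pi * t))]
  have hexp : ∀ y : ℝ, Complex.exp (-(y : ℂ) * Complex.I) =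
      ⟨Real.cos y, -Real.sin y⟩ := fun y => by
    rw [← Complex.ofReal_neg, Complex.exp_mul_I, ← Complex.ofReal_cos, ← Complex.ofReal_sin,
      Real.cos_neg, Real.sin_neg, Complex.mk_eq_add_mul_I]
  unfold arcResidue
  rw [hexp]
  rcases e with ⟨_ | _, p⟩ <;> rcases e' with ⟨_ | _, p'⟩
  · simp only [forall_true_left] at h
    rcases h with rfl | rfl <;>
      simp [startDir, arcVelocity, arcTurn] <;> linarith
  · simp [startDir, arcVelocity, arcTurn]
  · simp [startDir, arcVelocity, arcTurn, Complex.div_re]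
  · simp only [forall_true_left] at h
    rcases h with rfl | rfl <;>
      simp [startDir, arcVelocity, arcTurn, Complex.div_re, Complex.div_im] <;> linarith

lemma continuous_arcVelocity (e e' : ArcEnd) : Continuous (arcVelocity e e') := by
  have : arcVelocity e e' = fun t =>
      ((arcVelocity e e' t).re : ℂ) + (arcVelocity e e' t).im * Complex.I := by
    funext t; exact (Complex.re_add_im _).symm
  rw [this]
  rcases e with ⟨_ | _, p⟩ <;> rcases e' with ⟨_ | _, p'⟩ <;> simp only [arcVelocity] <;> fun_prop

/-- A tangent angle along an arc, measured from the initial direction; its total increase is `π`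
times `arcTurn`. -/
theorem exists_arcAngle (e e' : ArcEnd)
    (h : e'.upper = e.upper → e'.pos = e.pos + 1 ∨ e.pos = e'.pos + 1) :
    ∃ δ : ℝ → ℝ, Continuous δ ∧ δ 0 = 0 ∧ δ 1 = Real.pi * arcTurn e e' ∧
      ∀ t, arcVelocity e e' t ≠ 0 ∧ arcVelocity e e' t =
        ‖arcVelocity e e' t‖ * (startDir e * Complex.exp (δ t * Complex.I)) := by
  have hne := startDir_ne_zero e
  have hvel : ∀ t, arcVelocity e e' t = arcResidue e e' t *
      (startDir e * Complex.exp ((Real.pi * arcTurn e e' * t : ℝ) * Complex.I)) := fun t => by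
    unfold arcResidue
    rw [show arcVelocity e e' t / startDir e *
        Complex.exp (-(Real.pi * arcTurn e e' * t : ℝ) * Complex.I) * (startDir e *
        Complex.exp ((Real.pi * arcTurn e e' * t : ℝ) * Complex.I)) =
      arcVelocity e e' t / startDir e * startDir e *
        (Complex.exp (-(Real.pi * arcTurn e e' * t : ℝ) * Complex.I) *
        Complex.exp ((Real.pi * arcTurn e e' * t : ℝ) * Complex.I)) by ring, ← Complex.exp_add,
      div_mul_cancel₀ _ hne]
    simp
  have hres0 : arcResidue e e' 0 = 1 := by
    rw [arcResidue, arcVelocity_zero, div_self hne]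
    simp
  have hres1 : arcResidue e e' 1 = 1 := by
    rw [arcResidue, arcVelocity_one, neg_startDir e e', mul_div_cancel_left₀ _ hne,
      ← Complex.exp_add]
    simp
  have hslit : ∀ t, arcResidue e e' t ∈ Complex.slitPlane := fun t =>
    Or.inl (arcResidue_re_pos e e' h t)
  have hcont : Continuous (arcResidue e e') := by
    unfold arcResidue
    have := continuous_arcVelocity e e'
    fun_prop
  refine ⟨fun t => Real.pi * arcTurn e e' * t + (arcResidue e e' t).arg, ?_, ?_, ?_, fun t => ?_⟩
  · refine Continuous.add (by fun_prop) ?_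
    rw [continuous_iff_continuousAt]
    exact fun t => (Complex.continuousAt_arg (hslit t)).comp hcont.continuousAt
  · simp [hres0]
  · simp [hres1]
  · have hr : arcResidue e e' t ≠ 0 := Complex.slitPlane_ne_zero (hslit t)
    constructor
    · rw [hvel]
      exact mul_ne_zero hr (mul_ne_zero hne (Complex.exp_ne_zero _))
    · have hnorm : ‖arcVelocity e e' t‖ = ‖arcResidue e e' t‖ := by
        rw [hvel, norm_mul, norm_mul, norm_startDir, Complex.norm_exp_ofReal_mul_I]
        simp
      rw [hnorm]
      conv_lhs => rw [hvel, ← Complex.norm_mul_exp_arg_mul_I (arcResidue e e' t)]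
      push_cast
      rw [add_mul, Complex.exp_add]
      ring

end Arc

/-! ### The Whitney degree of a state curve -/

/-- Summation over `ℤ`: the angles at the joints of the doubly infinite path are the sums of the
turns. -/
lemma exists_int_primitive (g : ℤ → ℤ) : ∃ b : ℤ → ℤ, b 0 = 0 ∧ ∀ n, b (n + 1) = b n + g n := by
  refine ⟨fun n => match n with
    | .ofNat m => ∑ j ∈ Finset.range m, g j
    | .negSucc m => -∑ j ∈ Finset.range (m + 1), g (.negSucc j), rfl, fun n => ?_⟩
  rcases n with m | m
  · exact Finset.sum_range_succ (fun j : ℕ => g j) m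
  · rcases m with _ | m
    · change (0 : ℤ) = -∑ j ∈ Finset.range 1, g (.negSucc j) + g (.negSucc 0)
      simp
    · change -∑ j ∈ Finset.range (m + 1), g (.negSucc j) =
        -∑ j ∈ Finset.range (m + 1 + 1), g (.negSucc j) + g (.negSucc (m + 1))
      rw [Finset.sum_range_succ _ (m + 1)]
      ring

namespace Diagram
variable {K : Diagram} (S : K.State) (x : K.Dart)

lemma raw_iterate (n : ℕ) : ((nextPerm S)^[n] x).raw = (K.next S)^[n] x.raw := by
  induction n with
  | zero => rfl
  | succ n ih => rw [Function.iterate_succ_apply', Function.iterate_succ_apply', raw_nextPerm, ih]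

lemma period_eq : period S x = Function.minimalPeriod (nextPerm S) x := by
  refine Function.minimalPeriod_eq_minimalPeriod_iff.2 fun n => ?_
  rw [Function.IsPeriodicPt, Function.IsFixedPt, ← raw_iterate, Dart.raw_injective.eq_iff]
  rfl

lemma period_pos : 0 < period S x := by
  rw [period_eq]
  exact Function.minimalPeriod_pos_of_mem_periodicPts
    ((nextPerm S).injective.mem_periodicPts x)

lemma iterate_period : (nextPerm S)^[period S x] x = x := by
  rw [period_eq]
  exact Function.iterate_minimalPeriod

lemma zpow_eq_iterate (n : ℤ) :
    (nextPerm S ^ n) x = (nextPerm S)^[(n % (period S x : ℤ)).toNat] x := by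
  have hT : ((period S x : ℕ) : ℤ) ≠ 0 := by exact_mod_cast (period_pos S x).ne'
  have hfix : (nextPerm S ^ ((period S x : ℕ) : ℤ)) x = x := by
    rw [zpow_natCast, ← Equiv.Perm.iterate_eq_pow, iterate_period]
  conv_lhs => rw [← Int.emod_add_mul_ediv n (period S x), zpow_add, zpow_mul,
    Equiv.Perm.mul_apply, Equiv.Perm.zpow_apply_eq_self_of_apply_eq_self hfix]
  rw [Equiv.Perm.iterate_eq_pow, ← zpow_natCast, Int.toNat_of_nonneg (Int.emod_nonneg _ hT)]

/-- The half turns, counted in the order in which the curve runs through its arcs. -/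
lemma cycleTurn_eq_sum_range :
    cycleTurn S x = ∑ j ∈ Finset.range (period S x), dartTurn S ((nextPerm S ^ (j : ℤ)) x) := by
  classical
  rw [cycleTurn]
  symm
  refine Finset.sum_bij (fun j _ => (nextPerm S ^ (j : ℤ)) x) ?_ ?_ ?_ ?_
  · intro j _
    simp only [Finset.mem_filter, Finset.mem_univ, true_and]
    exact ⟨j, rfl⟩
  · intro j hj j' hj' h
    rw [period_eq, Finset.mem_range] at hj hj'
    rw [zpow_natCast, zpow_natCast, ← Equiv.Perm.iterate_eq_pow, ← Equiv.Perm.iterate_eq_pow] at h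
    exact Function.iterate_injOn_Iio_minimalPeriod hj hj' h
  · intro y hy
    simp only [Finset.mem_filter, Finset.mem_univ, true_and] at hy
    obtain ⟨n, rfl⟩ := hy
    have hT : (0 : ℤ) < (period S x : ℕ) := by exact_mod_cast period_pos S x
    refine ⟨(n % (period S x : ℤ)).toNat, ?_, ?_⟩
    · rw [Finset.mem_range]
      have := Int.emod_lt_of_pos n hT
      have := Int.emod_nonneg n hT.ne'
      omega
    · rw [zpow_eq_iterate S x n, Equiv.Perm.iterate_eq_pow, zpow_natCast]
  · exact fun _ _ => rfl

lemma otherEnd_raw_eq (y : K.Dart) :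
    K.otherEnd S y.raw.layer y.raw.start = (rev S y).raw.start := by
  rw [raw_rev, reverse]

lemma curvePath_eq_glue : curvePath S x = glue fun n => arcPath ((nextPerm S ^ n) x).raw.layer
    ((nextPerm S ^ n) x).raw.start (rev S ((nextPerm S ^ n) x)).raw.start := by
  funext t
  simp only [glue, curvePath]
  rw [zpow_eq_iterate, ← otherEnd_raw_eq, raw_iterate]

lemma startDir_nextPerm (y : K.Dart) :
    startDir (nextPerm S y).raw.start = -startDir (rev S y).raw.start := by
  rw [nextPerm_apply, raw_flip, flipRaw]
  split_ifs with h <;> simp [startDir, h]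

lemma endPoint_nextPerm (y : K.Dart) :
    endPoint (nextPerm S y).raw.layer (nextPerm S y).raw.start =
      endPoint y.raw.layer (rev S y).raw.start := by
  have h0 := layer_pos_of_lower (rev S y)
  have hl : (rev S y).raw.layer = y.raw.layer := by rw [raw_rev]; rfl
  rw [nextPerm_apply, raw_flip, flipRaw]
  rw [hl] at h0 ⊢
  split_ifs with h
  · simp [endPoint, h]
  · have h1 : 1 ≤ y.raw.layer := h0 (by simpa using h)
    simp only [endPoint, h]
    push_cast [h1]
    simp

/-- The number of half turns is twice the Whitney degree. The tangent angles along the arcs, added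
up over the preceding arcs, fit together to a tangent angle along the curve. -/
theorem exists_whitneyDegree_eq :
    ∃ n : ℤ, cycleTurn S x = 2 * n ∧ whitneyDegree (curvePath S x) (period S x) = n := by
  set d : ℤ → K.Dart := fun n => (nextPerm S ^ n) x with hd
  have hdn : ∀ n, d (n + 1) = nextPerm S (d n) := fun n => by
    simp only [hd]
    rw [add_comm, zpow_one_add, Equiv.Perm.mul_apply]
  choose δ hδc hδ0 hδ1 hδ using fun n => exists_arcAngle (d n).raw.start (rev S (d n)).raw.start
    (fun h => by
      rw [start_rev] at h ⊢
      exact FlatPiece.pos_otherEnd_of_upper_eq _ _ _ _ ((d n).isEnd S) h)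
  obtain ⟨b, hb0, hb⟩ := exists_int_primitive fun n => dartTurn S (d n)
  obtain ⟨β, hβ⟩ : ∃ β : ℝ, startDir x.raw.start = Complex.exp (β * Complex.I) := by
    unfold startDir
    split_ifs
    · refine ⟨-(Real.pi / 2), ?_⟩
      push_cast
      rw [neg_mul, Complex.exp_neg, Complex.exp_pi_div_two_mul_I, Complex.inv_I]
    · refine ⟨Real.pi / 2, ?_⟩
      push_cast
      rw [Complex.exp_pi_div_two_mul_I]
  have hstep : ∀ n, startDir (d (n + 1)).raw.start = startDir (d n).raw.start *
      Complex.exp ((Real.pi * dartTurn S (d n) : ℝ) * Complex.I) := fun n => by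
    rw [hdn, startDir_nextPerm, neg_startDir (d n).raw.start]
    rfl
  have hdir : ∀ n : ℤ, startDir (d n).raw.start =
      Complex.exp ((β + Real.pi * b n : ℝ) * Complex.I) := by
    have hexp : ∀ n, Complex.exp ((β + Real.pi * b (n + 1) : ℝ) * Complex.I) =
        Complex.exp ((β + Real.pi * b n : ℝ) * Complex.I) *
          Complex.exp ((Real.pi * dartTurn S (d n) : ℝ) * Complex.I) := fun n => by
      rw [← Complex.exp_add, hb]
      push_cast
      ring_nf
    intro n
    induction n using Int.induction_on with
    | zero => simpa [hb0, hd] using hβ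
    | succ n ih => rw [hstep, ih, hexp]
    | pred n ih =>
      have h1 := hstep (-n - 1)
      have h2 := hexp (-n - 1)
      rw [sub_add_cancel] at h1 h2
      rw [h1, h2] at ih
      exact mul_right_cancel₀ (Complex.exp_ne_zero _) ih
  -- Velocity and angle along the `n`-th arc: `β + π b n` is the angle at its start.
  set v : ℤ → ℝ → ℂ := fun n => arcVelocity (d n).raw.start (rev S (d n)).raw.start with hv
  set φ : ℤ → ℝ → ℝ := fun n t => β + Real.pi * b n + δ n t with hφ
  have hder : ∀ t, HasDerivAt (curvePath S x) (glue v t) t := by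
    rw [curvePath_eq_glue]
    refine hasDerivAt_glue (fun n t => hasDerivAt_arcPath _ _ _ t) (fun n => ?_) (fun n => ?_)
    · rw [arcPath_one, arcPath_zero, ← endPoint_nextPerm]
      exact (congrArg (fun y : K.Dart => endPoint y.raw.layer y.raw.start) (hdn n)).symm
    · simp only [hv]
      rw [arcVelocity_one, arcVelocity_zero, hdn, startDir_nextPerm]
  have hang : IsTangentAngle (curvePath S x) (glue φ) := by
    refine ⟨continuous_glue (fun n => continuous_const.add (hδc n)) fun n => ?_, fun t => ?_⟩
    · simp only [hφ, hδ0, hδ1, hb]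
      rw [dartTurn]
      push_cast
      ring
    · refine ⟨(hder t).differentiableAt, ?_⟩
      rw [(hder t).deriv]
      refine ⟨(hδ ⌊t⌋ (Int.fract t)).1, ?_⟩
      refine (hδ ⌊t⌋ (Int.fract t)).2.trans ?_
      rw [hdir, ← Complex.exp_add]
      simp only [glue, hφ, hv]
      push_cast
      ring_nf
  have hbT : ∀ m : ℕ, b m = ∑ j ∈ Finset.range m, dartTurn S (d j) := by
    intro m
    induction m with
    | zero => simpa using hb0
    | succ m ih => rw [Finset.sum_range_succ, ← ih]; exact_mod_cast hb m
  have hTot : b (period S x) = cycleTurn S x := by rw [hbT, cycleTurn_eq_sum_range]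
  -- The direction is the same after one period, so the number of half turns is even.
  have heven : Even (cycleTurn S x) := by
    have h1 : d (period S x) = x := by
      simp only [hd]
      rw [zpow_natCast, ← Equiv.Perm.iterate_eq_pow, iterate_period]
    have h2 := hdir (period S x)
    rw [h1, hβ, hTot] at h2
    obtain ⟨m, hm⟩ := Complex.exp_eq_exp_iff_exists_int.1 h2.symm
    refine ⟨m, ?_⟩
    have h3 : ((β + Real.pi * cycleTurn S x : ℝ) : ℂ) = ((β + m * (2 * Real.pi) : ℝ) : ℂ) := by
      apply mul_right_cancel₀ Complex.I_ne_zero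
      rw [hm]; push_cast; ring
    have h4 : Real.pi * cycleTurn S x = Real.pi * ((m + m : ℤ) : ℝ) := by
      have : β + Real.pi * cycleTurn S x = β + m * (2 * Real.pi) := by exact_mod_cast h3
      push_cast
      linarith
    exact_mod_cast mul_left_cancel₀ Real.pi_ne_zero h4
  obtain ⟨n, hn⟩ := heven
  refine ⟨n, by omega, whitneyDegree_eq hang ?_⟩
  have hg : ∀ m : ℤ, glue φ m = β + Real.pi * b m := fun m => by
    simp [glue, hφ, hδ0]
  have h1 := hg (period S x)
  have h0 := hg 0
  rw [hTot, hn] at h1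
  push_cast at h1 h0
  rw [h1, h0, hb0]
  push_cast
  ring

end Diagram

/-! ### The state sum formulas -/

namespace Diagram
variable {K : Diagram} {R : Type*} [CommRing R]

/-- `Curve.rot` is an absolute value, so the half turns are known up to sign; `u ^ t + u ^ (-t)`
does not depend on the sign. -/
lemma cycleTurn_base_eq_or {S : K.State} (C : Curve S) :
    cycleTurn S C.base = 2 * C.rot ∨ cycleTurn S C.base = -(2 * C.rot) := by
  obtain ⟨n, h1, h2⟩ := exists_whitneyDegree_eq S C.base
  have hrot : C.rot = n.natAbs := congrArg Int.natAbs h2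
  rw [h1, hrot]
  omega

lemma zpow_cycleTurn_add (u : Rˣ) {S : K.State} (C : Curve S) :
    ((u ^ cycleTurn S C.base : Rˣ) : R) + ((u ^ (-cycleTurn S C.base) : Rˣ) : R) =
      (u : R) ^ (2 * C.rot) + ((u⁻¹ : Rˣ) : R) ^ (2 * C.rot) := by
  have h1 : ((u ^ (2 * C.rot : ℤ) : Rˣ) : R) = (u : R) ^ (2 * C.rot) := by
    rw [← Units.val_pow_eq_pow_val, ← zpow_natCast]
    push_cast
    rfl
  have h2 : ((u ^ (-(2 * C.rot : ℤ)) : Rˣ) : R) = ((u⁻¹ : Rˣ) : R) ^ (2 * C.rot) := by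
    rw [← Units.val_pow_eq_pow_val, ← zpow_natCast, zpow_neg, inv_zpow]
    push_cast
    rfl
  rcases cycleTurn_base_eq_or C with h | h
  · rw [h, h1, h2]
  · rw [h, neg_neg, h1, h2, add_comm]

theorem stateSum_eq_prod_rot (u : Rˣ) (S : K.State) : K.stateSum u S =
    ∏ C : Curve S, ((u : R) ^ (2 * C.rot) + ((u⁻¹ : Rˣ) : R) ^ (2 * C.rot)) := by
  rw [stateSum_eq_prod]
  exact Finset.prod_congr rfl fun C _ => zpow_cycleTurn_add u C

lemma Curve.value_eq (A u : Rˣ) (hu : (u : R) ^ 2 = -(A : R) ^ 2)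
    (hu' : ((u⁻¹ : Rˣ) : R) ^ 2 = -((A⁻¹ : Rˣ) : R) ^ 2) {S : K.State} (C : Curve S) :
    C.value A = (u : R) ^ (2 * C.rot) + ((u⁻¹ : Rˣ) : R) ^ (2 * C.rot) := by
  rw [Curve.value, pow_mul (u : R), pow_mul ((u⁻¹ : Rˣ) : R), hu, hu', neg_pow ((A : R) ^ 2),
    neg_pow (((A⁻¹ : Rˣ) : R) ^ 2),
    ← pow_mul, ← pow_mul, mul_add]

/-- In a state without virtual crossings, the circles removed by `exists_stateSum_eq_pow` are as
many as the curves. -/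
theorem stateSum_eq_pow_card (u : Rˣ) (S : K.State) (hK : K.IsClassical) : K.stateSum u S =
    ((u : R) ^ 2 + ((u⁻¹ : Rˣ) : R) ^ 2) ^ Fintype.card (Curve S) := by
  -- Working over `R × ℤ` yields the same exponent for `R` and for `ℤ`. The unit `1` of `ℤ` gives
  -- every curve the value `2`, whatever its Whitney degree, so the exponent counts the curves.
  let w : (R × ℤ)ˣ := MulEquiv.prodUnits.symm (u, 1)
  obtain ⟨N, hN⟩ := K.exists_stateSum_eq_pow w S hK
  have h1 : K.stateSum u S = ((u : R) ^ 2 + ((u⁻¹ : Rˣ) : R) ^ 2) ^ N := by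
    have := congrArg (RingHom.fst R ℤ) hN
    rw [stateSum_eq_prod_rot, map_prod] at this
    simp only [map_add, map_pow] at this
    rw [stateSum_eq_prod_rot]
    exact this
  have h2 : (2 : ℤ) ^ Fintype.card (Curve S) = 2 ^ N := by
    have := congrArg (RingHom.snd R ℤ) hN
    rw [stateSum_eq_prod_rot, map_prod] at this
    simp only [map_add, map_pow] at this
    have h : ∏ C : Curve S, ((1 : ℤ) ^ (2 * C.rot) + 1 ^ (2 * C.rot)) = (1 ^ 2 + 1 ^ 2) ^ N := this
    simpa [one_add_one_eq_two] using h
  rw [h1, Int.pow_right_injective (by norm_num) h2]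

/-- In a non-empty diagram, the lowest layer begins on a line without points. So it contains a
minimum, whose arc lies on some curve. -/
lemma nonempty_curve (S : K.State) (hK : K.word ≠ []) : Nonempty (Curve S) := by
  have h0 : 0 < K.size := List.length_pos_of_ne_nil hK
  have hb := K.width_bot ⟨0, h0⟩
  have hins : (K.layer ⟨0, h0⟩).piece.ins = 0 := by
    simp only [width, Layer.bot] at hb
    omega
  have hout : 0 < (K.layer ⟨0, h0⟩).top := by
    unfold Layer.top
    cases hP : (K.layer ⟨0, h0⟩).piece <;> rw [hP] at hins <;> simp [Piece.ins, Piece.outs] at *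
  exact ⟨Curve.mk S ⟨⟨0, h0⟩, .inr ⟨0, hout⟩⟩⟩

end Diagram
end VirtualKnot

theorem proposition9 {R : Type*} [CommRing R] (A : Rˣ) (i : R) (hi : i ^ 2 = -1) :
    (∀ K K' : VirtualKnot.Diagram, VirtualKnot.VirtualRegularIsotopic K K' →
      VirtualKnot.Diagram.Z A i K = VirtualKnot.Diagram.Z A i K') ∧
    (∀ K : VirtualKnot.Diagram, VirtualKnot.Diagram.Z A i K =
      ∑ S : K.State, VirtualKnot.Diagram.weight A S *
        ∏ C : VirtualKnot.Diagram.Curve S, C.value A) ∧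
    (∀ K : VirtualKnot.Diagram, K.IsClassical → K.word ≠ [] →
      VirtualKnot.Diagram.Z A i K =
        VirtualKnot.Diagram.loopValue A * VirtualKnot.Diagram.bracket A K) := by
  obtain ⟨u, hu, hM⟩ := VirtualKnot.tensorM_eq A i hi
  have hu' : ((u⁻¹ : Rˣ) : R) = -(i * ((A⁻¹ : Rˣ) : R)) := by
    have := congrFun (congrFun hM 1) 0
    simpa [VirtualKnot.tensorM, VirtualKnot.Box.unitM] using this.symm
  have h2 : (u : R) ^ 2 = -(A : R) ^ 2 := by
    rw [hu]; linear_combination (A : R) ^ 2 * hi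
  have h2' : ((u⁻¹ : Rˣ) : R) ^ 2 = -((A⁻¹ : Rˣ) : R) ^ 2 := by
    rw [hu']; linear_combination ((A⁻¹ : Rˣ) : R) ^ 2 * hi
  refine ⟨fun K K' h => VirtualKnot.Diagram.Z_eq_of_isotopic A i hi h, fun K => ?_,
    fun K hK hne => ?_⟩
  · rw [K.Z_eq_sum_stateSum A i u hM]
    refine Finset.sum_congr rfl fun S _ => ?_
    rw [VirtualKnot.Diagram.stateSum_eq_prod_rot]
    congr 1
    exact Finset.prod_congr rfl fun C _ => (C.value_eq A u h2 h2').symm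
  · rw [K.Z_eq_sum_stateSum A i u hM, VirtualKnot.Diagram.bracket, Finset.mul_sum]
    refine Finset.sum_congr rfl fun S _ => ?_
    have hpos : 0 < Fintype.card (VirtualKnot.Diagram.Curve S) :=
      Fintype.card_pos_iff.2 (VirtualKnot.Diagram.nonempty_curve S hne)
    rw [VirtualKnot.Diagram.stateSum_eq_pow_card u S hK, h2, h2', ← sub_eq_add_neg]
    change _ = VirtualKnot.Diagram.loopValue A * (_ * VirtualKnot.Diagram.loopValue A ^ _)
    rw [mul_left_comm, ← pow_succ', Nat.sub_add_cancel hpos]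
    rfl
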